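/- Rings are associative and need not have an identity. A set $E$ of idempotents of a ring $A$ is a set of local units of $A$ if for every finite subset $F\subseteq A$ there is $e\in E$ with $ea=ae=a$ for all $a\in F$. A unital $A$-bimodule is an $A$-bimodule $M$ with $AM=M=MA$. Let $R\subseteq S$ be an extension of rings with the same set of local units, i.e. there is a set $E\subseteq R$ that is a set of local units of both $R$ and $S$. Let $\mathcal M(S/R)$ be the following monoidal category. Its objects are the $R$-bilinear maps $\phi\colon P\to X$, with $P$ a unital $R$-bimodule and $X$ a unital $S$-bimodule, such that the maps $P\otimes_R S\to X$, $p\otimes s\mapsto \phi(p)s$, and $S\otimes_R P\to X$, $s\otimes p\mapsto s\phi(p)$, are isomorphisms (of $(R,S)$-bimodules and of $(S,R)$-bimodules, respectively). Its morphisms from $\phi\colon P\to X$ to $\phi'\colon P'\to X'$ are the pairs $(\alpha,\beta)$ with $\alpha\colon P\to P'$ $R$-bilinear, $\beta\colon X\to X'$ $S$-bilinear and $\beta\phi=\phi'\alpha$. The product of $\phi\colon P\to X$ and $\psi\colon Q\to Y$ is $P\otimes_R Q\to X\otimes_S Y$, $p\otimes q\mapsto\phi(p)\otimes\psi(q)$,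 the product of morphisms is $(\alpha\otimes_R\mu,\beta\otimes_S\nu)$, and the unit object is the inclusion $R\to S$; the associativity and unit constraints are the canonical ones. Let $\mathcal S(S/R)$ be the monoid of isomorphism classes of objects of $\mathcal M(S/R)$, with the induced multiplication and unit. For a ring $A$ with local units, $\mathrm{Pic}(A)$ is the set of isomorphism classes $[P]$ of unital $A$-bimodules $P$ for which there is a unital $A$-bimodule $Q$ with $Q\otimes_A P\cong A\cong P\otimes_A Q$ as $A$-bimodules. Let $\mathcal P(S/R)\subseteq\mathcal S(S/R)$ be the submonoid of the classes of the objects $\phi\colon P\to X$ with $[P]\in\mathrm{Pic}(R)$ and $[X]\in\mathrm{Pic}(S)$. Then $\mathcal P(S/R)$ is exactly the group of units of the monoid $\mathcal S(S/R)$. -/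

import Mathlib

open CategoryTheory MonoidalCategory
open scoped TensorProduct

noncomputable section

universe u v

namespace UnitalBimodules

/-! ### Rings with local units (rings are associative and need not have an identity) -/

/-- `E` is a set of local units of the ring `A`: it consists of idempotents, and every finite
subset of `A` has a common two-sided unit lying in `E`. -/
def IsSetOfLocalUnits {A : Type u} [NonUnitalRing A] (E : Set A) : Prop :=
  (∀ e ∈ E, e * e = e) ∧ ∀ F : Finset A, ∃ e ∈ E, ∀ a ∈ F, e * a = a ∧ a * e = a

/-- `A` is a ring with local units. -/
class HasLocalUnits (A : Type u) [NonUnitalRing A] : Prop where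
  exists_localUnits : ∃ E : Set A, IsSetOfLocalUnits E

/-- `R ⊆ S` is an extension of rings with the same set of local units: there is a set `E ⊆ R`
which is a set of local units of `R` and also a set of local units of `S`. -/
class IsLocalUnitsExtension {S : Type u} [NonUnitalRing S] (R : NonUnitalSubring S) : Prop where
  exists_localUnits : ∃ E : Set R,
    IsSetOfLocalUnits E ∧ IsSetOfLocalUnits ((fun e : R => (e : S)) '' E)

instance {S : Type u} [NonUnitalRing S] (R : NonUnitalSubring S) [IsLocalUnitsExtension R] :
    HasLocalUnits R :=
  let ⟨E, h, _⟩ := IsLocalUnitsExtension.exists_localUnits (R := R)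
  ⟨E, h⟩

theorem IsLocalUnitsExtension.hasLocalUnits {S : Type u} [NonUnitalRing S]
    (R : NonUnitalSubring S) [IsLocalUnitsExtension R] : HasLocalUnits S :=
  let ⟨_, _, h⟩ := IsLocalUnitsExtension.exists_localUnits (R := R)
  ⟨_, h⟩

/-! ### The tensor product over a (possibly nonunital, noncommutative) ring -/

section Balanced

variable {I : Type*} {M N : Type u} [AddCommGroup M] [AddCommGroup N]

/-- The subgroup of `M ⊗_ℤ N` generated by the elements `(m · i) ⊗ n - m ⊗ (i · n)`. -/
def balancedRel (ρ : I → M →+ M) (σ : I → N →+ N) : AddSubgroup (M ⊗[ℤ] N) :=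
  AddSubgroup.closure {t | ∃ i m n, t = (ρ i m) ⊗ₜ[ℤ] n - m ⊗ₜ[ℤ] (σ i n)}

/-- The tensor product `M ⊗_I N` of abelian groups, where `ρ` is the right action of `I` on `M`
and `σ` is the left action of `I` on `N`: the quotient of `M ⊗_ℤ N` by the relations
`(m · i) ⊗ n = m ⊗ (i · n)`. -/
def Tens (ρ : I → M →+ M) (σ : I → N →+ N) : Type u :=
  (M ⊗[ℤ] N) ⧸ balancedRel ρ σ

namespace Tens

instance (ρ : I → M →+ M) (σ : I → N →+ N) : AddCommGroup (Tens ρ σ) :=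
  inferInstanceAs (AddCommGroup ((M ⊗[ℤ] N) ⧸ balancedRel ρ σ))

/-- The class of `m ⊗ n`, as a biadditive map. -/
def mk (ρ : I → M →+ M) (σ : I → N →+ N) : M →+ N →+ Tens ρ σ where
  toFun m :=
    { toFun := fun n => QuotientAddGroup.mk' (balancedRel ρ σ) (m ⊗ₜ[ℤ] n)
      map_zero' := by rw [TensorProduct.tmul_zero]; exact map_zero _
      map_add' := fun a b => by rw [TensorProduct.tmul_add]; exact map_add _ _ _ }
  map_zero' := by
    ext n
    show QuotientAddGroup.mk' (balancedRel ρ σ) _ = 0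
    rw [TensorProduct.zero_tmul, map_zero]
  map_add' a b := by
    ext n
    show QuotientAddGroup.mk' (balancedRel ρ σ) _ = QuotientAddGroup.mk' (balancedRel ρ σ) _ +
      QuotientAddGroup.mk' (balancedRel ρ σ) _
    rw [TensorProduct.add_tmul, map_add]

variable {ρ : I → M →+ M} {σ : I → N →+ N}

theorem balanced (i : I) (m : M) (n : N) : mk ρ σ (ρ i m) n = mk ρ σ m (σ i n) := by
  show QuotientAddGroup.mk' (balancedRel ρ σ) _ = QuotientAddGroup.mk' (balancedRel ρ σ) _
  rw [← sub_eq_zero, ← map_sub]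
  exact (QuotientAddGroup.eq_zero_iff _).2 (AddSubgroup.subset_closure ⟨i, m, n, rfl⟩)

/-- The additive map out of the tensor product induced by a balanced biadditive map. -/
def lift {K : Type*} [AddCommGroup K] (f : M →+ N →+ K)
    (hf : ∀ i m n, f (ρ i m) n = f m (σ i n)) : Tens ρ σ →+ K :=
  QuotientAddGroup.lift (balancedRel ρ σ)
    (TensorProduct.liftAddHom f (fun (z : ℤ) m n => by simp)) (by
      rw [balancedRel, AddSubgroup.closure_le]
      rintro _ ⟨i, m, n, rfl⟩
      simp [AddMonoidHom.mem_ker, hf])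

@[simp]
theorem lift_mk {K : Type*} [AddCommGroup K] (f : M →+ N →+ K)
    (hf : ∀ i m n, f (ρ i m) n = f m (σ i n)) (m : M) (n : N) :
    lift f hf (mk ρ σ m n) = f m n := rfl

@[elab_as_elim]
theorem induction {p : Tens ρ σ → Prop} (t : Tens ρ σ) (hmk : ∀ m n, p (mk ρ σ m n))
    (hadd : ∀ a b, p a → p b → p (a + b)) : p t := by
  obtain ⟨t, rfl⟩ := QuotientAddGroup.mk'_surjective (balancedRel ρ σ) t
  induction t using TensorProduct.induction_on with
  | zero =>
    have h := hmk 0 0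
    rw [map_zero] at h
    exact h
  | tmul m n => exact hmk m n
  | add a b ha hb => exact hadd _ _ ha hb

theorem hom_ext {K : Type*} [AddCommGroup K] {f g : Tens ρ σ →+ K}
    (h : ∀ m n, f (mk ρ σ m n) = g (mk ρ σ m n)) : f = g := by
  ext t
  exact induction (p := fun t => f t = g t) t h (fun a b ha hb => by rw [map_add, map_add, ha, hb])

theorem ext_apply {K : Type*} [AddCommGroup K] (f g : Tens ρ σ →+ K)
    (h : ∀ m n, f (mk ρ σ m n) = g (mk ρ σ m n)) (t : Tens ρ σ) : f t = g t :=
  DFunLike.congr_fun (hom_ext h) t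

theorem hom_ext₁ {J : Type*} {L : Type u} [AddCommGroup L] {α : J → Tens ρ σ →+ Tens ρ σ}
    {β : J → L →+ L} {K : Type*} [AddCommGroup K] {f g : Tens α β →+ K}
    (h : ∀ m n l, f (mk α β (mk ρ σ m n) l) = g (mk α β (mk ρ σ m n) l)) : f = g :=
  hom_ext fun t l => ext_apply (f.comp ((mk α β).flip l)) (g.comp ((mk α β).flip l))
    (fun m n => h m n l) t

theorem hom_ext₂ {J : Type*} {L : Type u} [AddCommGroup L] {α : J → L →+ L}
    {β : J → Tens ρ σ →+ Tens ρ σ} {K : Type*} [AddCommGroup K] {f g : Tens α β →+ K}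
    (h : ∀ l m n, f (mk α β l (mk ρ σ m n)) = g (mk α β l (mk ρ σ m n))) : f = g :=
  hom_ext fun l t => ext_apply (f.comp (mk α β l)) (g.comp (mk α β l))
    (fun m n => h l m n) t

variable {M' N' : Type u} [AddCommGroup M'] [AddCommGroup N']
  {ρ' : I → M' →+ M'} {σ' : I → N' →+ N'}

/-- The tensor product of two additive maps compatible with the actions. -/
def map (f : M →+ M') (g : N →+ N') (hf : ∀ i m, f (ρ i m) = ρ' i (f m))
    (hg : ∀ i n, g (σ i n) = σ' i (g n)) : Tens ρ σ →+ Tens ρ' σ' :=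
  lift ((((mk ρ' σ').comp f).flip.comp g).flip) (fun i m n => by
    simp [hf, hg, balanced])

@[simp]
theorem map_mk (f : M →+ M') (g : N →+ N') (hf : ∀ i m, f (ρ i m) = ρ' i (f m))
    (hg : ∀ i n, g (σ i n) = σ' i (g n)) (m : M) (n : N) :
    map f g hf hg (mk ρ σ m n) = mk ρ' σ' (f m) (g n) := rfl

theorem map_bijective (f : M →+ M') (g : N →+ N') (hf : ∀ i m, f (ρ i m) = ρ' i (f m))
    (hg : ∀ i n, g (σ i n) = σ' i (g n)) (bf : Function.Bijective f)
    (bg : Function.Bijective g) : Function.Bijective (map f g hf hg) := by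
  let f' := (AddEquiv.ofBijective f bf).symm.toAddMonoidHom
  let g' := (AddEquiv.ofBijective g bg).symm.toAddMonoidHom
  have f1 : ∀ m, f' (f m) = m := (AddEquiv.ofBijective f bf).symm_apply_apply
  have f2 : ∀ m, f (f' m) = m := (AddEquiv.ofBijective f bf).apply_symm_apply
  have g1 : ∀ m, g' (g m) = m := (AddEquiv.ofBijective g bg).symm_apply_apply
  have g2 : ∀ m, g (g' m) = m := (AddEquiv.ofBijective g bg).apply_symm_apply
  have hf' : ∀ i m, f' (ρ' i m) = ρ i (f' m) := fun i m => bf.1 (by rw [f2, hf, f2])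
  have hg' : ∀ i m, g' (σ' i m) = σ i (g' m) := fun i m => bg.1 (by rw [g2, hg, g2])
  refine Function.bijective_iff_has_inverse.2 ⟨map f' g' hf' hg', fun t => ?_, fun t => ?_⟩
  · refine DFunLike.congr_fun (f := (map f' g' hf' hg').comp (map f g hf hg))
      (g := AddMonoidHom.id _) (hom_ext fun m n => ?_) t
    simp [f1, g1]
  · refine DFunLike.congr_fun (f := (map f g hf hg).comp (map f' g' hf' hg'))
      (g := AddMonoidHom.id _) (hom_ext fun m n => ?_) t
    simp [f2, g2]

end Tens

end Balanced

section Assoc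

variable {I J : Type*} {M N K : Type u} [AddCommGroup M] [AddCommGroup N] [AddCommGroup K]
  (ρ : I → M →+ M) (σ : I → N →+ N) (τ : J → N →+ N) (υ : J → K →+ K)
  (hστ : ∀ i j n, σ i (τ j n) = τ j (σ i n))

/-- The action on `M ⊗ N` through the second factor. -/
def Tens.actR (j : J) : Tens ρ σ →+ Tens ρ σ :=
  Tens.map (AddMonoidHom.id M) (τ j) (fun _ _ => rfl) (fun i n => (hστ i j n).symm)

/-- The action on `N ⊗ K` through the first factor. -/
def Tens.actL (i : I) : Tens τ υ →+ Tens τ υ :=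
  Tens.map (σ i) (AddMonoidHom.id K) (fun j n => hστ i j n) (fun _ _ => rfl)

/-- The map `m ⊗ n ↦ m ⊗ (n ⊗ k)`. -/
def Tens.insR (k : K) : Tens ρ σ →+ Tens ρ (Tens.actL σ τ υ hστ) :=
  Tens.map (AddMonoidHom.id M) ((Tens.mk τ υ).flip k) (fun _ _ => rfl) (fun _ _ => rfl)

/-- The map `n ⊗ k ↦ (m ⊗ n) ⊗ k`. -/
def Tens.insL (m : M) : Tens τ υ →+ Tens (Tens.actR ρ σ τ hστ) υ :=
  Tens.map (Tens.mk ρ σ m) (AddMonoidHom.id K) (fun _ _ => rfl) (fun _ _ => rfl)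

theorem Tens.insR_mk (k : K) (m : M) (n : N) :
    Tens.insR ρ σ τ υ hστ k (Tens.mk ρ σ m n) = Tens.mk _ _ m (Tens.mk _ _ n k) := rfl

theorem Tens.insL_mk (m : M) (n : N) (k : K) :
    Tens.insL ρ σ τ υ hστ m (Tens.mk τ υ n k) = Tens.mk _ _ (Tens.mk _ _ m n) k := rfl

theorem Tens.insR_add (a b : K) :
    Tens.insR ρ σ τ υ hστ (a + b) = Tens.insR ρ σ τ υ hστ a + Tens.insR ρ σ τ υ hστ b :=
  Tens.hom_ext fun m n => by
    rw [AddMonoidHom.add_apply, Tens.insR_mk, Tens.insR_mk, Tens.insR_mk, map_add, map_add]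

theorem Tens.insL_add (a b : M) :
    Tens.insL ρ σ τ υ hστ (a + b) = Tens.insL ρ σ τ υ hστ a + Tens.insL ρ σ τ υ hστ b :=
  Tens.hom_ext fun n k => by
    rw [AddMonoidHom.add_apply, Tens.insL_mk, Tens.insL_mk, Tens.insL_mk, map_add,
      AddMonoidHom.add_apply, map_add, AddMonoidHom.add_apply]

/-- The canonical map `(M ⊗ N) ⊗ K → M ⊗ (N ⊗ K)`. -/
def Tens.assocHom :
    Tens (Tens.actR ρ σ τ hστ) υ →+ Tens ρ (Tens.actL σ τ υ hστ) :=
  Tens.lift (AddMonoidHom.flip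
      (AddMonoidHom.mk' (Tens.insR ρ σ τ υ hστ) (Tens.insR_add ρ σ τ υ hστ)))
    (fun j t k => Tens.ext_apply
      ((Tens.insR ρ σ τ υ hστ k).comp (Tens.actR ρ σ τ hστ j)) (Tens.insR ρ σ τ υ hστ (υ j k))
      (fun m n => congrArg (Tens.mk ρ (Tens.actL σ τ υ hστ) m) (Tens.balanced j n k)) t)

/-- The canonical map `M ⊗ (N ⊗ K) → (M ⊗ N) ⊗ K`. -/
def Tens.assocInv :
    Tens ρ (Tens.actL σ τ υ hστ) →+ Tens (Tens.actR ρ σ τ hστ) υ :=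
  Tens.lift (AddMonoidHom.mk' (Tens.insL ρ σ τ υ hστ) (Tens.insL_add ρ σ τ υ hστ))
    (fun i m t => Tens.ext_apply
      (Tens.insL ρ σ τ υ hστ (ρ i m)) ((Tens.insL ρ σ τ υ hστ m).comp (Tens.actL σ τ υ hστ i))
      (fun n k => congrArg (fun x => Tens.mk (Tens.actR ρ σ τ hστ) υ x k)
        (Tens.balanced i m n)) t)

theorem Tens.assocHom_mk (m : M) (n : N) (k : K) :
    Tens.assocHom ρ σ τ υ hστ (Tens.mk _ _ (Tens.mk _ _ m n) k) =
      Tens.mk _ _ m (Tens.mk _ _ n k) := rfl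

theorem Tens.assocInv_mk (m : M) (n : N) (k : K) :
    Tens.assocInv ρ σ τ υ hστ (Tens.mk _ _ m (Tens.mk _ _ n k)) =
      Tens.mk _ _ (Tens.mk _ _ m n) k := rfl

/-- The associativity isomorphism `(M ⊗ N) ⊗ K ≃ M ⊗ (N ⊗ K)`. -/
def Tens.assoc : Tens (Tens.actR ρ σ τ hστ) υ ≃+ Tens ρ (Tens.actL σ τ υ hστ) :=
  AddMonoidHom.toAddEquiv (Tens.assocHom ρ σ τ υ hστ) (Tens.assocInv ρ σ τ υ hστ)
    (Tens.hom_ext₁ fun m n k => by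
      rw [AddMonoidHom.comp_apply, Tens.assocHom_mk, Tens.assocInv_mk, AddMonoidHom.id_apply])
    (Tens.hom_ext₂ fun m n k => by
      rw [AddMonoidHom.comp_apply, Tens.assocInv_mk, Tens.assocHom_mk, AddMonoidHom.id_apply])

theorem Tens.assoc_mk (m : M) (n : N) (k : K) :
    Tens.assoc ρ σ τ υ hστ (Tens.mk _ _ (Tens.mk _ _ m n) k) =
      Tens.mk _ _ m (Tens.mk _ _ n k) := rfl

end Assoc

/-! ### Unital bimodules -/

/-- A unital `A`-bimodule: an abelian group with commuting left and right actions of `A`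
(`l a x` is `a · x` and `r a x` is `x · a`), such that `A X = X` and `X A = X`, where `A X` and
`X A` consist of the finite sums of elements `a · x`, respectively `x · a`. -/
structure UBimod (A : Type u) [NonUnitalRing A] : Type (u + 1) where
  carrier : Type u
  [addCommGroup : AddCommGroup carrier]
  l : A →+ carrier →+ carrier
  r : A →+ carrier →+ carrier
  l_mul : ∀ a b x, l (a * b) x = l a (l b x)
  r_mul : ∀ a b x, r (a * b) x = r b (r a x)
  lr : ∀ a b x, l a (r b x) = r b (l a x)
  l_unital : AddSubgroup.closure {y | ∃ a x, y = l a x} = ⊤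
  r_unital : AddSubgroup.closure {y | ∃ a x, y = r a x} = ⊤

instance (A : Type u) [NonUnitalRing A] : CoeSort (UBimod A) (Type u) := ⟨UBimod.carrier⟩

attribute [instance] UBimod.addCommGroup

section Unital

variable {A : Type u} [NonUnitalRing A]

theorem IsSetOfLocalUnits.exists_unit {E : Set A} (hE : IsSetOfLocalUnits E) (a b : A) :
    ∃ e ∈ E, e * a = a ∧ a * e = a ∧ e * b = b ∧ b * e = b := by
  classical
  obtain ⟨e, he, h⟩ := hE.2 {a, b}
  exact ⟨e, he, (h a (by simp)).1, (h a (by simp)).2, (h b (by simp)).1, (h b (by simp)).2⟩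

/-- Over a ring with set of local units `E`, an element of a left unital module is fixed by
some `e ∈ E`. -/
theorem exists_unit_left {E : Set A} (hE : IsSetOfLocalUnits E) {M : Type*} [AddCommGroup M]
    (l : A →+ M →+ M) (l_mul : ∀ a b x, l (a * b) x = l a (l b x))
    (l_unital : AddSubgroup.closure {y | ∃ a x, y = l a x} = ⊤) (x : M) :
    ∃ e ∈ E, l e x = x := by
  have hx : x ∈ AddSubgroup.closure {y | ∃ a x, y = l a x} := by rw [l_unital]; trivial
  induction hx using AddSubgroup.closure_induction with
  | mem y hy =>
    obtain ⟨a, x, rfl⟩ := hy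
    obtain ⟨e, he, h, -⟩ := hE.exists_unit a a
    exact ⟨e, he, by rw [← l_mul, h]⟩
  | zero =>
    obtain ⟨e, he, -⟩ := hE.exists_unit 0 0
    exact ⟨e, he, map_zero _⟩
  | add y z _ _ hy hz =>
    obtain ⟨a, -, ha⟩ := hy
    obtain ⟨b, -, hb⟩ := hz
    obtain ⟨e, he, h1, -, h2, -⟩ := hE.exists_unit a b
    refine ⟨e, he, ?_⟩
    rw [map_add]
    conv_lhs => rw [← ha, ← hb, ← l_mul, ← l_mul, h1, h2, ha, hb]
  | neg y _ hy =>
    obtain ⟨a, h, ha⟩ := hy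
    exact ⟨a, h, by rw [map_neg, ha]⟩

theorem exists_unit_right {E : Set A} (hE : IsSetOfLocalUnits E) {M : Type*} [AddCommGroup M]
    (r : A →+ M →+ M) (r_mul : ∀ a b x, r (a * b) x = r b (r a x))
    (r_unital : AddSubgroup.closure {y | ∃ a x, y = r a x} = ⊤) (x : M) :
    ∃ e ∈ E, r e x = x := by
  have hx : x ∈ AddSubgroup.closure {y | ∃ a x, y = r a x} := by rw [r_unital]; trivial
  induction hx using AddSubgroup.closure_induction with
  | mem y hy =>
    obtain ⟨a, x, rfl⟩ := hy
    obtain ⟨e, he, -, h, -⟩ := hE.exists_unit a a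
    exact ⟨e, he, by rw [← r_mul, h]⟩
  | zero =>
    obtain ⟨e, he, -⟩ := hE.exists_unit 0 0
    exact ⟨e, he, map_zero _⟩
  | add y z _ _ hy hz =>
    obtain ⟨a, -, ha⟩ := hy
    obtain ⟨b, -, hb⟩ := hz
    obtain ⟨e, he, -, h1, -, h2⟩ := hE.exists_unit a b
    refine ⟨e, he, ?_⟩
    rw [map_add]
    conv_lhs => rw [← ha, ← hb, ← r_mul, ← r_mul, h1, h2, ha, hb]
  | neg y _ hy =>
    obtain ⟨a, h, ha⟩ := hy
    exact ⟨a, h, by rw [map_neg, ha]⟩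

/-- The multiplication map `A ⊗_A M → M` is bijective for a left unital module `M`. -/
theorem lid_bijective {E : Set A} (hE : IsSetOfLocalUnits E) {M : Type u} [AddCommGroup M]
    (l : A → M →+ M) (hu : ∀ x, ∃ e, l e x = x)
    (F : Tens (fun a => AddMonoidHom.mul.flip a) l →+ M)
    (hF : ∀ a m, F (Tens.mk _ _ a m) = l a m) : Function.Bijective F := by
  have key : ∀ t, ∃ e ∈ E, ∀ f, f * e = e → t = Tens.mk _ _ f (F t) := by
    intro t
    refine Tens.induction t (fun a m => ?_) (fun x y hx hy => ?_)
    · obtain ⟨e, he, h, -⟩ := hE.exists_unit a a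
      refine ⟨e, he, fun f hf => ?_⟩
      rw [hF, ← Tens.balanced]
      have : f * a = a := by rw [← h, ← mul_assoc, hf]
      exact congrArg (fun z => Tens.mk _ _ z m) this.symm
    · obtain ⟨a, -, ha⟩ := hx
      obtain ⟨b, -, hb⟩ := hy
      obtain ⟨e, he, h1, -, h2, -⟩ := hE.exists_unit a b
      refine ⟨e, he, fun f hf => ?_⟩
      rw [map_add, map_add, ← ha f (by rw [← h1, ← mul_assoc, hf]),
        ← hb f (by rw [← h2, ← mul_assoc, hf])]
  refine ⟨(injective_iff_map_eq_zero F).2 fun t ht => ?_, fun x => ?_⟩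
  · obtain ⟨e, he, h⟩ := key t
    rw [h e (hE.1 e he), ht, map_zero]
  · obtain ⟨e, he⟩ := hu x
    exact ⟨Tens.mk _ _ e x, by rw [hF, he]⟩

/-- The multiplication map `M ⊗_A A → M` is bijective for a right unital module `M`. -/
theorem rid_bijective {E : Set A} (hE : IsSetOfLocalUnits E) {M : Type u} [AddCommGroup M]
    (r : A → M →+ M) (hu : ∀ x, ∃ e, r e x = x)
    (F : Tens r (fun a => AddMonoidHom.mul a) →+ M)
    (hF : ∀ m a, F (Tens.mk _ _ m a) = r a m) : Function.Bijective F := by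
  have key : ∀ t, ∃ e ∈ E, ∀ f, e * f = e → t = Tens.mk _ _ (F t) f := by
    intro t
    refine Tens.induction t (fun m a => ?_) (fun x y hx hy => ?_)
    · obtain ⟨e, he, -, h, -⟩ := hE.exists_unit a a
      refine ⟨e, he, fun f hf => ?_⟩
      rw [hF, Tens.balanced]
      have : a * f = a := by rw [← h, mul_assoc, hf]
      exact congrArg (fun z => Tens.mk _ _ m z) this.symm
    · obtain ⟨a, -, ha⟩ := hx
      obtain ⟨b, -, hb⟩ := hy
      obtain ⟨e, he, -, h1, -, h2⟩ := hE.exists_unit a b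
      refine ⟨e, he, fun f hf => ?_⟩
      rw [map_add, map_add, AddMonoidHom.add_apply, ← ha f (by rw [← h1, mul_assoc, hf]),
        ← hb f (by rw [← h2, mul_assoc, hf])]
  refine ⟨(injective_iff_map_eq_zero F).2 fun t ht => ?_, fun x => ?_⟩
  · obtain ⟨e, he, h⟩ := key t
    rw [h e (hE.1 e he), ht, map_zero, AddMonoidHom.zero_apply]
  · obtain ⟨e, he⟩ := hu x
    exact ⟨Tens.mk _ _ x e, by rw [hF, he]⟩

end Unital

namespace UBimod

section Category

variable {A : Type u} [NonUnitalRing A]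

/-- Bilinear maps between unital bimodules. -/
@[ext]
structure Hom (P Q : UBimod A) : Type u where
  toAddHom : P →+ Q
  map_l : ∀ a x, toAddHom (P.l a x) = Q.l a (toAddHom x)
  map_r : ∀ a x, toAddHom (P.r a x) = Q.r a (toAddHom x)

/-- The category of unital `A`-bimodules. -/
instance : Category.{u} (UBimod A) where
  Hom P Q := Hom P Q
  id P := ⟨AddMonoidHom.id P, fun _ _ => rfl, fun _ _ => rfl⟩
  comp f g := ⟨g.toAddHom.comp f.toAddHom, fun a x => by simp [f.map_l, g.map_l],
    fun a x => by simp [f.map_r, g.map_r]⟩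

@[ext]
theorem hom_ext {P Q : UBimod A} {f g : P ⟶ Q} (h : f.toAddHom = g.toAddHom) : f = g :=
  Hom.ext h

@[simp] theorem id_toAddHom (P : UBimod A) : Hom.toAddHom (𝟙 P) = AddMonoidHom.id P := rfl

@[simp] theorem comp_toAddHom {P Q K : UBimod A} (f : P ⟶ Q) (g : Q ⟶ K) :
    Hom.toAddHom (f ≫ g) = g.toAddHom.comp f.toAddHom := rfl

/-- A bijective bilinear map is an isomorphism. -/
def isoOfBijective {P Q : UBimod A} (f : P ⟶ Q) (hf : Function.Bijective f.toAddHom) : P ≅ Q where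
  hom := f
  inv := ⟨(AddEquiv.ofBijective f.toAddHom hf).symm.toAddMonoidHom,
    fun a x => hf.1 (by
      rw [f.map_l]
      erw [(AddEquiv.ofBijective f.toAddHom hf).apply_symm_apply,
        (AddEquiv.ofBijective f.toAddHom hf).apply_symm_apply]),
    fun a x => hf.1 (by
      rw [f.map_r]
      erw [(AddEquiv.ofBijective f.toAddHom hf).apply_symm_apply,
        (AddEquiv.ofBijective f.toAddHom hf).apply_symm_apply])⟩
  hom_inv_id := by ext x; exact (AddEquiv.ofBijective f.toAddHom hf).symm_apply_apply x
  inv_hom_id := by ext x; exact (AddEquiv.ofBijective f.toAddHom hf).apply_symm_apply x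

/-- The tensor product `P ⊗_A Q` of two unital bimodules, with `a · (p ⊗ q) = (a · p) ⊗ q` and
`(p ⊗ q) · a = p ⊗ (q · a)`. -/
def tensorProd (P Q : UBimod A) : UBimod A where
  carrier := Tens P.r Q.l
  l := AddMonoidHom.mk' (fun a => Tens.actL P.l P.r Q.l P.lr a) (fun a b =>
    Tens.hom_ext fun m n =>
      (congrArg (fun z => Tens.mk P.r Q.l (z m) n) (P.l.map_add a b)).trans
        (((Tens.mk P.r Q.l).flip n).map_add (P.l a m) (P.l b m)))
  r := AddMonoidHom.mk' (fun a => Tens.actR P.r Q.l Q.r Q.lr a) (fun a b =>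
    Tens.hom_ext fun m n =>
      (congrArg (fun z => Tens.mk P.r Q.l m (z n)) (Q.r.map_add a b)).trans
        ((Tens.mk P.r Q.l m).map_add (Q.r a n) (Q.r b n)))
  l_mul a b := Tens.ext_apply (Tens.actL P.l P.r Q.l P.lr (a * b))
    ((Tens.actL P.l P.r Q.l P.lr a).comp (Tens.actL P.l P.r Q.l P.lr b))
    (fun m n => congrArg (fun z => Tens.mk P.r Q.l z n) (P.l_mul a b m))
  r_mul a b := Tens.ext_apply (Tens.actR P.r Q.l Q.r Q.lr (a * b))
    ((Tens.actR P.r Q.l Q.r Q.lr b).comp (Tens.actR P.r Q.l Q.r Q.lr a))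
    (fun m n => congrArg (fun z => Tens.mk P.r Q.l m z) (Q.r_mul a b n))
  lr a b := Tens.ext_apply
    ((Tens.actL P.l P.r Q.l P.lr a).comp (Tens.actR P.r Q.l Q.r Q.lr b))
    ((Tens.actR P.r Q.l Q.r Q.lr b).comp (Tens.actL P.l P.r Q.l P.lr a))
    (fun _ _ => rfl)
  l_unital := by
    rw [eq_top_iff]
    rintro t -
    refine Tens.induction t (fun m n => ?_) (fun x y hx hy => add_mem hx hy)
    have hm : m ∈ AddSubgroup.closure {y | ∃ a x, y = P.l a x} := by rw [P.l_unital]; trivial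
    have h := (AddSubgroup.closure_le (k := {y | ∃ a x, y = P.l a x})
      (AddSubgroup.comap ((Tens.mk P.r Q.l).flip n)
      (AddSubgroup.closure {y | ∃ a x, y = Tens.actL P.l P.r Q.l P.lr a x}))).2 ?_ hm
    · exact h
    rintro _ ⟨a, x, rfl⟩
    exact AddSubgroup.subset_closure ⟨a, Tens.mk _ _ x n, rfl⟩
  r_unital := by
    rw [eq_top_iff]
    rintro t -
    refine Tens.induction t (fun m n => ?_) (fun x y hx hy => add_mem hx hy)
    have hm : n ∈ AddSubgroup.closure {y | ∃ a x, y = Q.r a x} := by rw [Q.r_unital]; trivial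
    have h := (AddSubgroup.closure_le (k := {y | ∃ a x, y = Q.r a x})
      (AddSubgroup.comap (Tens.mk P.r Q.l m)
      (AddSubgroup.closure {y | ∃ a x, y = Tens.actR P.r Q.l Q.r Q.lr a x}))).2 ?_ hm
    · exact h
    rintro _ ⟨a, x, rfl⟩
    exact AddSubgroup.subset_closure ⟨a, Tens.mk _ _ m x, rfl⟩

/-- The element `p ⊗ q`. -/
def tmul {P Q : UBimod A} (p : P) (q : Q) : tensorProd P Q := Tens.mk P.r Q.l p q

theorem tens_ext {P Q : UBimod A} {K : Type*} [AddCommGroup K] (f g : tensorProd P Q →+ K)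
    (h : ∀ p q, f (tmul p q) = g (tmul p q)) (t : tensorProd P Q) : f t = g t :=
  Tens.ext_apply (ρ := P.r) (σ := Q.l) f g h t

theorem tens_ext₃ {P Q K : UBimod A} {L : Type*} [AddCommGroup L]
    (f g : tensorProd (tensorProd P Q) K →+ L)
    (h : ∀ p q k, f (tmul (tmul p q) k) = g (tmul (tmul p q) k))
    (t : tensorProd (tensorProd P Q) K) : f t = g t :=
  tens_ext f g (fun t k => tens_ext
    (f.comp ((Tens.mk (tensorProd P Q).r K.l).flip k))
    (g.comp ((Tens.mk (tensorProd P Q).r K.l).flip k)) (fun p q => h p q k) t) t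

theorem tens_ext₄ {P Q K N : UBimod A} {L : Type*} [AddCommGroup L]
    (f g : tensorProd (tensorProd (tensorProd P Q) K) N →+ L)
    (h : ∀ p q k n, f (tmul (tmul (tmul p q) k) n) = g (tmul (tmul (tmul p q) k) n))
    (t : tensorProd (tensorProd (tensorProd P Q) K) N) : f t = g t :=
  tens_ext f g (fun t n => tens_ext₃
    (f.comp ((Tens.mk (tensorProd (tensorProd P Q) K).r N.l).flip n))
    (g.comp ((Tens.mk (tensorProd (tensorProd P Q) K).r N.l).flip n))
    (fun p q k => h p q k n) t) t

/-- The tensor product of two bilinear maps. -/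
def tensorMap {P P' Q Q' : UBimod A} (f : P ⟶ P') (g : Q ⟶ Q') :
    tensorProd P Q ⟶ tensorProd P' Q' where
  toAddHom := Tens.map f.toAddHom g.toAddHom f.map_r g.map_l
  map_l a := tens_ext
    ((Tens.map f.toAddHom g.toAddHom f.map_r g.map_l).comp ((tensorProd P Q).l a))
    (((tensorProd P' Q').l a).comp (Tens.map f.toAddHom g.toAddHom f.map_r g.map_l))
    (fun m n => congrArg (fun z => Tens.mk P'.r Q'.l z (g.toAddHom n)) (f.map_l a m))
  map_r a := tens_ext
    ((Tens.map f.toAddHom g.toAddHom f.map_r g.map_l).comp ((tensorProd P Q).r a))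
    (((tensorProd P' Q').r a).comp (Tens.map f.toAddHom g.toAddHom f.map_r g.map_l))
    (fun m n => congrArg (fun z => Tens.mk P'.r Q'.l (f.toAddHom m) z) (g.map_r a n))

/-- The canonical map `(P ⊗ Q) ⊗ K → P ⊗ (Q ⊗ K)`. -/
def assocAdd (P Q K : UBimod A) :
    tensorProd (tensorProd P Q) K →+ tensorProd P (tensorProd Q K) :=
  Tens.assocHom P.r Q.l Q.r K.l Q.lr

/-- The associativity constraint `(p ⊗ q) ⊗ k ↦ p ⊗ (q ⊗ k)`. -/
def assoc (P Q K : UBimod A) :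
    tensorProd (tensorProd P Q) K ≅ tensorProd P (tensorProd Q K) :=
  isoOfBijective
    { toAddHom := assocAdd P Q K
      map_l := fun a => tens_ext₃ ((assocAdd P Q K).comp ((tensorProd (tensorProd P Q) K).l a))
        (((tensorProd P (tensorProd Q K)).l a).comp (assocAdd P Q K)) (fun _ _ _ => rfl)
      map_r := fun a => tens_ext₃ ((assocAdd P Q K).comp ((tensorProd (tensorProd P Q) K).r a))
        (((tensorProd P (tensorProd Q K)).r a).comp (assocAdd P Q K)) (fun _ _ _ => rfl) }
    (Tens.assoc P.r Q.l Q.r K.l Q.lr).bijective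

theorem tensor_hom_ext {P Q K : UBimod A} {f g : tensorProd P Q ⟶ K}
    (h : ∀ p q, f.toAddHom (tmul p q) = g.toAddHom (tmul p q)) : f = g :=
  hom_ext (DFunLike.ext _ _ (tens_ext _ _ h))

theorem tensor_hom_ext₃ {P Q K L : UBimod A} {f g : tensorProd (tensorProd P Q) K ⟶ L}
    (h : ∀ p q k, f.toAddHom (tmul (tmul p q) k) = g.toAddHom (tmul (tmul p q) k)) : f = g :=
  hom_ext (DFunLike.ext _ _ (tens_ext₃ _ _ h))

theorem tensor_hom_ext₄ {P Q K N L : UBimod A}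
    {f g : tensorProd (tensorProd (tensorProd P Q) K) N ⟶ L}
    (h : ∀ p q k n, f.toAddHom (tmul (tmul (tmul p q) k) n) =
      g.toAddHom (tmul (tmul (tmul p q) k) n)) : f = g :=
  hom_ext (DFunLike.ext _ _ (tens_ext₄ _ _ h))

variable [HasLocalUnits A]

theorem exists_l (P : UBimod A) (x : P) : ∃ e, P.l e x = x :=
  let ⟨_, hE⟩ := HasLocalUnits.exists_localUnits (A := A)
  let ⟨e, _, h⟩ := exists_unit_left hE P.l P.l_mul P.l_unital x
  ⟨e, h⟩

theorem exists_r (P : UBimod A) (x : P) : ∃ e, P.r e x = x :=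
  let ⟨_, hE⟩ := HasLocalUnits.exists_localUnits (A := A)
  let ⟨e, _, h⟩ := exists_unit_right hE P.r P.r_mul P.r_unital x
  ⟨e, h⟩

variable (A) in
/-- The ring `A` as a unital bimodule over itself. -/
def unit : UBimod A where
  carrier := A
  l := AddMonoidHom.mul
  r := AddMonoidHom.mul.flip
  l_mul := mul_assoc
  r_mul a b x := (mul_assoc x a b).symm
  lr a b x := (mul_assoc a x b).symm
  l_unital := by
    obtain ⟨E, hE⟩ := HasLocalUnits.exists_localUnits (A := A)
    rw [eq_top_iff]
    rintro a -
    obtain ⟨e, -, h, -⟩ := hE.exists_unit a a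
    exact AddSubgroup.subset_closure ⟨e, a, h.symm⟩
  r_unital := by
    obtain ⟨E, hE⟩ := HasLocalUnits.exists_localUnits (A := A)
    rw [eq_top_iff]
    rintro a -
    obtain ⟨e, -, -, h, -⟩ := hE.exists_unit a a
    exact AddSubgroup.subset_closure ⟨e, a, h.symm⟩

/-- The canonical map `A ⊗ P → P`. -/
def lidAdd (P : UBimod A) : tensorProd (unit A) P →+ P :=
  Tens.lift (ρ := (unit A).r) (σ := P.l) P.l (fun i m n => P.l_mul m i n)

/-- The left unit constraint `a ⊗ p ↦ a · p`. -/
def lid (P : UBimod A) : tensorProd (unit A) P ≅ P :=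
  isoOfBijective
    { toAddHom := lidAdd P
      map_l := fun a => tens_ext ((lidAdd P).comp ((tensorProd (unit A) P).l a))
        ((P.l a).comp (lidAdd P)) (fun m n => P.l_mul a m n)
      map_r := fun a => tens_ext ((lidAdd P).comp ((tensorProd (unit A) P).r a))
        ((P.r a).comp (lidAdd P)) (fun m n => P.lr m a n) }
    (let ⟨_, hE⟩ := HasLocalUnits.exists_localUnits (A := A)
     lid_bijective hE P.l P.exists_l (lidAdd P) (fun _ _ => rfl))

/-- The canonical map `P ⊗ A → P`. -/
def ridAdd (P : UBimod A) : tensorProd P (unit A) →+ P :=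
  Tens.lift (ρ := P.r) (σ := (unit A).l) P.r.flip (fun i m n => (P.r_mul i n m).symm)

/-- The right unit constraint `p ⊗ a ↦ p · a`. -/
def rid (P : UBimod A) : tensorProd P (unit A) ≅ P :=
  isoOfBijective
    { toAddHom := ridAdd P
      map_l := fun a => tens_ext ((ridAdd P).comp ((tensorProd P (unit A)).l a))
        ((P.l a).comp (ridAdd P)) (fun m n => (P.lr a n m).symm)
      map_r := fun a => tens_ext ((ridAdd P).comp ((tensorProd P (unit A)).r a))
        ((P.r a).comp (ridAdd P)) (fun m n => P.r_mul n a m) }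
    (let ⟨_, hE⟩ := HasLocalUnits.exists_localUnits (A := A)
     rid_bijective hE P.r P.exists_r (ridAdd P) (fun _ _ => rfl))

/-- The monoidal category of unital bimodules over a ring with local units. -/
instance : MonoidalCategoryStruct (UBimod A) where
  tensorObj := tensorProd
  tensorHom f g := tensorMap f g
  whiskerLeft P _ _ g := tensorMap (𝟙 P) g
  whiskerRight f Q := tensorMap f (𝟙 Q)
  tensorUnit := unit A
  associator := assoc
  leftUnitor := lid
  rightUnitor := rid

instance : MonoidalCategory (UBimod A) :=
  MonoidalCategory.ofTensorHom
    (id_tensorHom_id := fun _ _ => tensor_hom_ext fun _ _ => rfl)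
    (id_tensorHom := fun _ _ _ _ => rfl)
    (tensorHom_id := fun _ _ => rfl)
    (tensorHom_comp_tensorHom := fun _ _ _ _ => tensor_hom_ext fun _ _ => rfl)
    (associator_naturality := fun _ _ _ => tensor_hom_ext₃ fun _ _ _ => rfl)
    (leftUnitor_naturality := fun f => tensor_hom_ext fun (a : A) x => (f.map_l a x).symm)
    (rightUnitor_naturality := fun f => tensor_hom_ext fun x (a : A) => (f.map_r a x).symm)
    (pentagon := fun _ _ _ _ => tensor_hom_ext₄ fun _ _ _ _ => rfl)
    (triangle := fun P Q => tensor_hom_ext₃ fun p (a : A) q =>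
      (Tens.balanced (ρ := P.r) (σ := Q.l) a p q).symm)

end Category

end UBimod

/-- The Picard group `Pic(A)`, as a subset of the monoid of isomorphism classes of unital
`A`-bimodules: the classes `[P]` for which there is a unital `A`-bimodule `Q` with
`Q ⊗_A P ≅ A ≅ P ⊗_A Q`. -/
def Pic (A : Type u) [NonUnitalRing A] [HasLocalUnits A] : Set (Skeleton (UBimod A)) :=
  {c | ∃ P Q : UBimod A, c = toSkeleton P ∧
    Nonempty (UBimod.tensorProd Q P ≅ UBimod.unit A) ∧
    Nonempty (UBimod.tensorProd P Q ≅ UBimod.unit A)}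

theorem mem_Pic_iff {A : Type u} [NonUnitalRing A] [HasLocalUnits A] (c : Skeleton (UBimod A)) :
    c ∈ Pic A ↔ IsUnit c := by
  constructor
  · rintro ⟨P, Q, rfl, ⟨i⟩, ⟨j⟩⟩
    refine ⟨⟨toSkeleton P, toSkeleton Q, ?_, ?_⟩, rfl⟩
    · rw [← Skeleton.toSkeleton_tensorObj, Skeleton.one_eq]; exact Quotient.sound ⟨j⟩
    · rw [← Skeleton.toSkeleton_tensorObj, Skeleton.one_eq]; exact Quotient.sound ⟨i⟩
  · rintro ⟨⟨x, y, hxy, hyx⟩, rfl⟩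
    obtain ⟨P, rfl⟩ := Quotient.exists_rep x
    obtain ⟨Q, rfl⟩ := Quotient.exists_rep y
    exact ⟨P, Q, rfl,
      Quotient.exact ((Skeleton.toSkeleton_tensorObj Q P).trans hyx),
      Quotient.exact ((Skeleton.toSkeleton_tensorObj P Q).trans hxy)⟩

/-! ### The monoidal category `M(S/R)` -/

section Extension

variable {S : Type u} [NonUnitalRing S] (R : NonUnitalSubring S)

/-- For a unital `R`-bimodule `P`, a unital `S`-bimodule `X` and an additive map `φ : P → X`
compatible with the right `R`-actions, the map `P ⊗_R S → X`, `p ⊗ s ↦ φ(p) · s`. -/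
def phiR {R : NonUnitalSubring S} {P : UBimod R} {X : UBimod S} (φ : P →+ X)
    (map_r : ∀ (a : R) p, φ (P.r a p) = X.r (a : S) (φ p)) :
    Tens P.r (fun a : R => AddMonoidHom.mul (a : S)) →+ X :=
  Tens.lift (X.r.flip.comp φ) (fun a p s => by simp [map_r, X.r_mul])

/-- For a unital `R`-bimodule `P`, a unital `S`-bimodule `X` and an additive map `φ : P → X`
compatible with the left `R`-actions, the map `S ⊗_R P → X`, `s ⊗ p ↦ s · φ(p)`. -/
def phiL {R : NonUnitalSubring S} {P : UBimod R} {X : UBimod S} (φ : P →+ X)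
    (map_l : ∀ (a : R) p, φ (P.l a p) = X.l (a : S) (φ p)) :
    Tens (fun a : R => AddMonoidHom.mul.flip (a : S)) P.l →+ X :=
  Tens.lift ((X.l.flip.comp φ).flip) (fun a s p => by simp [map_l, X.l_mul])

/-- The objects of `M(S/R)`: `R`-bilinear maps `φ : P → X` from a unital `R`-bimodule `P` to a
unital `S`-bimodule `X` such that `P ⊗_R S → X` and `S ⊗_R P → X` are isomorphisms.  (These two
maps are automatically `(R,S)`-bilinear, respectively `(S,R)`-bilinear, so that being an
isomorphism means being bijective.) -/
structure MObj : Type (u + 1) where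
  P : UBimod R
  X : UBimod S
  φ : P →+ X
  map_l : ∀ (a : R) p, φ (P.l a p) = X.l (a : S) (φ p)
  map_r : ∀ (a : R) p, φ (P.r a p) = X.r (a : S) (φ p)
  bij_r : Function.Bijective (phiR φ map_r)
  bij_l : Function.Bijective (phiL φ map_l)

namespace MObj

variable {R}

/-- Morphisms of `M(S/R)`: pairs `(α, β)` with `β ∘ φ = φ' ∘ α`. -/
@[ext]
structure Hom (f g : MObj R) : Type u where
  α : f.P ⟶ g.P
  β : f.X ⟶ g.X
  comm : ∀ p, β.toAddHom (f.φ p) = g.φ (α.toAddHom p)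

instance : Category.{u} (MObj R) where
  Hom f g := Hom f g
  id f := ⟨𝟙 _, 𝟙 _, fun _ => rfl⟩
  comp u v := ⟨u.α ≫ v.α, u.β ≫ v.β, fun p => by simp [u.comm, v.comm]⟩

@[ext]
theorem hom_ext {f g : MObj R} {u v : f ⟶ g} (h1 : u.α = v.α) (h2 : u.β = v.β) : u = v :=
  Hom.ext h1 h2

@[simp] theorem id_α (f : MObj R) : Hom.α (𝟙 f) = 𝟙 f.P := rfl
@[simp] theorem id_β (f : MObj R) : Hom.β (𝟙 f) = 𝟙 f.X := rfl
@[simp] theorem comp_α {f g h : MObj R} (u : f ⟶ g) (v : g ⟶ h) :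
    Hom.α (u ≫ v) = u.α ≫ v.α := rfl
@[simp] theorem comp_β {f g h : MObj R} (u : f ⟶ g) (v : g ⟶ h) :
    Hom.β (u ≫ v) = u.β ≫ v.β := rfl

/-- An isomorphism in `M(S/R)` from isomorphisms of the components. -/
def mkIso {f g : MObj R} (α : f.P ≅ g.P) (β : f.X ≅ g.X)
    (comm : ∀ p, β.hom.toAddHom (f.φ p) = g.φ (α.hom.toAddHom p)) : f ≅ g where
  hom := ⟨α.hom, β.hom, comm⟩
  inv := ⟨α.inv, β.inv, fun p => by
    have h1 : ∀ p, α.hom.toAddHom (α.inv.toAddHom p) = p := fun p =>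
      DFunLike.congr_fun (congrArg UBimod.Hom.toAddHom α.inv_hom_id) p
    have h2 : ∀ x, β.inv.toAddHom (β.hom.toAddHom x) = x := fun x =>
      DFunLike.congr_fun (congrArg UBimod.Hom.toAddHom β.hom_inv_id) x
    conv_lhs => rw [← h1 p, ← comm, h2]⟩
  hom_inv_id := by ext1 <;> simp
  inv_hom_id := by ext1 <;> simp

/-- The map `P ⊗_R Q → X ⊗_R Y → X ⊗_S Y`, `p ⊗ q ↦ φ(p) ⊗ ψ(q)`. -/
def chi (f g : MObj R) : Tens f.P.r g.P.l →+ Tens f.X.r g.X.l :=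
  Tens.lift ((((Tens.mk f.X.r g.X.l).comp f.φ).flip.comp g.φ).flip) (fun a p q => by
    simp only [AddMonoidHom.flip_apply, AddMonoidHom.comp_apply, f.map_r, g.map_l]
    exact Tens.balanced (ρ := f.X.r) (σ := g.X.l) (a : S) _ _)

theorem chi_l (f g : MObj R) (a : R) (t : UBimod.tensorProd f.P g.P) :
    chi f g ((UBimod.tensorProd f.P g.P).l a t) =
      (UBimod.tensorProd f.X g.X).l (a : S) (chi f g t) :=
  Tens.ext_apply ((chi f g).comp ((UBimod.tensorProd f.P g.P).l a))
    (((UBimod.tensorProd f.X g.X).l (a : S)).comp (chi f g))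
    (fun m n => congrArg (fun z => Tens.mk f.X.r g.X.l z (g.φ n)) (f.map_l a m)) t

theorem chi_r (f g : MObj R) (a : R) (t : UBimod.tensorProd f.P g.P) :
    chi f g ((UBimod.tensorProd f.P g.P).r a t) =
      (UBimod.tensorProd f.X g.X).r (a : S) (chi f g t) :=
  Tens.ext_apply ((chi f g).comp ((UBimod.tensorProd f.P g.P).r a))
    (((UBimod.tensorProd f.X g.X).r (a : S)).comp (chi f g))
    (fun m n => congrArg (fun z => Tens.mk f.X.r g.X.l (f.φ m) z) (g.map_r a n)) t

variable [IsLocalUnitsExtension R]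

theorem chi_bij_r (f g : MObj R) : Function.Bijective
    (phiR (P := UBimod.tensorProd f.P g.P) (X := UBimod.tensorProd f.X g.X) (chi f g) (chi_r f g)) := by
  obtain ⟨E, -, hE⟩ := IsLocalUnitsExtension.exists_localUnits (R := R)
  have : HasLocalUnits S := ⟨_, hE⟩
  let lY : R → g.X →+ g.X := fun a => g.X.l (a : S)
  let k : Tens f.P.r lY →+ Tens f.X.r g.X.l :=
    Tens.lift ((Tens.mk f.X.r g.X.l).comp f.φ) (fun a p y => by
      simp only [AddMonoidHom.comp_apply, f.map_r]
      exact Tens.balanced (ρ := f.X.r) (σ := g.X.l) (a : S) _ _)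
  let mS : R → S →+ S := fun a => AddMonoidHom.mul (a : S)
  -- `(P ⊗_R S) ⊗_S Y ≃ P ⊗_R (S ⊗_S Y) ≃ P ⊗_R Y`
  let rS : S → S →+ S := fun a => AddMonoidHom.mul.flip a
  have hS : ∀ (i : R) (j n : S), mS i (rS j n) = rS j (mS i n) :=
    fun i j n => (mul_assoc (i : S) n j).symm
  let e := Tens.assoc f.P.r mS rS g.X.l hS
  let mY : Tens rS g.X.l →+ g.X :=
    Tens.lift g.X.l (fun i m n => g.X.l_mul m i n)
  have bmY : Function.Bijective mY := lid_bijective hE g.X.l g.X.exists_l mY (fun _ _ => rfl)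
  let e2 : Tens f.P.r (Tens.actL mS rS g.X.l hS) →+ Tens f.P.r lY :=
    Tens.map (AddMonoidHom.id _) mY (fun _ _ => rfl) (fun i =>
      Tens.ext_apply (mY.comp (Tens.actL mS rS g.X.l hS i)) ((lY i).comp mY)
        (fun s y => g.X.l_mul i s y))
  have be2 : Function.Bijective e2 := Tens.map_bijective _ _ _ _ Function.bijective_id bmY
  -- `(P ⊗_R S) ⊗_S Y ≃ X ⊗_S Y`
  let h : Tens (Tens.actR f.P.r mS rS hS) g.X.l →+ Tens f.X.r g.X.l :=
    Tens.map (phiR f.φ f.map_r) (AddMonoidHom.id _) (fun s =>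
      Tens.ext_apply ((phiR f.φ f.map_r).comp (Tens.actR f.P.r mS rS hS s))
        ((f.X.r s).comp (phiR f.φ f.map_r)) (fun p s' => f.X.r_mul s' s (f.φ p))) (fun _ _ => rfl)
  have bh : Function.Bijective h := Tens.map_bijective _ _ _ _ f.bij_r Function.bijective_id
  have hk : k.comp (e2.comp e.toAddMonoidHom) = h := Tens.hom_ext₁ fun p s y =>
    (Tens.balanced (ρ := f.X.r) (σ := g.X.l) s (f.φ p) y).symm
  have bk : Function.Bijective k := by
    have h1 : Function.Bijective (k ∘ (e2.comp e.toAddMonoidHom)) := by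
      rw [← AddMonoidHom.coe_comp, hk]; exact bh
    exact (Function.Bijective.of_comp_iff k (be2.comp e.bijective)).1 h1
  -- `(P ⊗_R Q) ⊗_R S ≃ P ⊗_R (Q ⊗_R S) ≃ P ⊗_R Y`
  let e' := Tens.assoc f.P.r g.P.l g.P.r mS g.P.lr
  let e2' : Tens f.P.r (Tens.actL g.P.l g.P.r mS g.P.lr) →+ Tens f.P.r lY :=
    Tens.map (AddMonoidHom.id _) (phiR g.φ g.map_r) (fun _ _ => rfl) (fun i =>
      Tens.ext_apply ((phiR g.φ g.map_r).comp (Tens.actL g.P.l g.P.r mS g.P.lr i))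
        ((lY i).comp (phiR g.φ g.map_r)) (fun q s => by
          show g.X.r s (g.φ (g.P.l i q)) = g.X.l (i : S) (g.X.r s (g.φ q))
          rw [g.map_l, g.X.lr]))
  have be2' : Function.Bijective e2' :=
    Tens.map_bijective _ _ _ _ Function.bijective_id g.bij_r
  have hfin : phiR (P := UBimod.tensorProd f.P g.P) (X := UBimod.tensorProd f.X g.X) (chi f g)
      (chi_r f g) = k.comp (e2'.comp e'.toAddMonoidHom) := Tens.hom_ext₁ fun _ _ _ => rfl
  rw [hfin]
  exact bk.comp (be2'.comp e'.bijective)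

theorem chi_bij_l (f g : MObj R) : Function.Bijective
    (phiL (P := UBimod.tensorProd f.P g.P) (X := UBimod.tensorProd f.X g.X) (chi f g) (chi_l f g)) := by
  obtain ⟨E, -, hE⟩ := IsLocalUnitsExtension.exists_localUnits (R := R)
  have : HasLocalUnits S := ⟨_, hE⟩
  let rX : R → f.X →+ f.X := fun a => f.X.r (a : S)
  let k : Tens rX g.P.l →+ Tens f.X.r g.X.l :=
    Tens.lift (((Tens.mk f.X.r g.X.l).flip.comp g.φ).flip) (fun a x q => by
      simp only [AddMonoidHom.flip_apply, AddMonoidHom.comp_apply, g.map_l]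
      exact Tens.balanced (ρ := f.X.r) (σ := g.X.l) (a : S) _ _)
  let mS : S → S →+ S := fun a => AddMonoidHom.mul a
  let rS : R → S →+ S := fun a => AddMonoidHom.mul.flip (a : S)
  have hS : ∀ (i : S) (j : R) (n : S), mS i (rS j n) = rS j (mS i n) :=
    fun i j n => (mul_assoc i n (j : S)).symm
  -- `X ⊗_S (S ⊗_R Q) ≃ (X ⊗_S S) ⊗_R Q ≃ X ⊗_R Q`
  let e := (Tens.assoc f.X.r mS rS g.P.l hS).symm
  let mX : Tens f.X.r mS →+ f.X :=
    Tens.lift f.X.r.flip (fun i m n => (f.X.r_mul i n m).symm)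
  have bmX : Function.Bijective mX := rid_bijective hE f.X.r f.X.exists_r mX (fun _ _ => rfl)
  let e2 : Tens (Tens.actR f.X.r mS rS hS) g.P.l →+ Tens rX g.P.l :=
    Tens.map mX (AddMonoidHom.id _) (fun i =>
      Tens.ext_apply (mX.comp (Tens.actR f.X.r mS rS hS i)) ((rX i).comp mX)
        (fun x s => f.X.r_mul s i x)) (fun _ _ => rfl)
  have be2 : Function.Bijective e2 := Tens.map_bijective _ _ _ _ bmX Function.bijective_id
  -- `X ⊗_S (S ⊗_R Q) ≃ X ⊗_S Y`
  let h : Tens f.X.r (Tens.actL mS rS g.P.l hS) →+ Tens f.X.r g.X.l :=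
    Tens.map (AddMonoidHom.id _) (phiL g.φ g.map_l) (fun _ _ => rfl) (fun s =>
      Tens.ext_apply ((phiL g.φ g.map_l).comp (Tens.actL mS rS g.P.l hS s))
        ((g.X.l s).comp (phiL g.φ g.map_l)) (fun s' q => g.X.l_mul s s' (g.φ q)))
  have bh : Function.Bijective h := Tens.map_bijective _ _ _ _ Function.bijective_id g.bij_l
  have hk : k.comp (e2.comp e.toAddMonoidHom) = h := Tens.hom_ext₂ fun x s q =>
    Tens.balanced (ρ := f.X.r) (σ := g.X.l) s x (g.φ q)
  have bk : Function.Bijective k := by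
    have h1 : Function.Bijective (k ∘ (e2.comp e.toAddMonoidHom)) := by
      rw [← AddMonoidHom.coe_comp, hk]; exact bh
    exact (Function.Bijective.of_comp_iff k (be2.comp e.bijective)).1 h1
  -- `S ⊗_R (P ⊗_R Q) ≃ (S ⊗_R P) ⊗_R Q ≃ X ⊗_R Q`
  let e' := (Tens.assoc rS f.P.l f.P.r g.P.l f.P.lr).symm
  let e2' : Tens (Tens.actR rS f.P.l f.P.r f.P.lr) g.P.l →+ Tens rX g.P.l :=
    Tens.map (phiL f.φ f.map_l) (AddMonoidHom.id _) (fun i =>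
      Tens.ext_apply ((phiL f.φ f.map_l).comp (Tens.actR rS f.P.l f.P.r f.P.lr i))
        ((rX i).comp (phiL f.φ f.map_l)) (fun s p => by
          show f.X.l s (f.φ (f.P.r i p)) = f.X.r (i : S) (f.X.l s (f.φ p))
          rw [f.map_r, f.X.lr])) (fun _ _ => rfl)
  have be2' : Function.Bijective e2' :=
    Tens.map_bijective _ _ _ _ f.bij_l Function.bijective_id
  have hfin : phiL (P := UBimod.tensorProd f.P g.P) (X := UBimod.tensorProd f.X g.X) (chi f g)
      (chi_l f g) = k.comp (e2'.comp e'.toAddMonoidHom) := Tens.hom_ext₂ fun _ _ _ => rfl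
  rw [hfin]
  exact bk.comp (be2'.comp e'.bijective)

/-- The product of `φ : P → X` and `ψ : Q → Y` in `M(S/R)`: the map
`P ⊗_R Q → X ⊗_S Y`, `p ⊗ q ↦ φ(p) ⊗ ψ(q)`. -/
def tensorProd (f g : MObj R) : MObj R where
  P := UBimod.tensorProd f.P g.P
  X := UBimod.tensorProd f.X g.X
  φ := chi f g
  map_l := chi_l f g
  map_r := chi_r f g
  bij_r := chi_bij_r f g
  bij_l := chi_bij_l f g

variable (R) in
/-- The unit object of `M(S/R)`: the inclusion `R → S`. -/
def unit : MObj R :=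
  have : HasLocalUnits S := IsLocalUnitsExtension.hasLocalUnits R
  { P := UBimod.unit R
    X := UBimod.unit S
    φ := (R.subtype : R →+ S)
    map_l := fun _ _ => rfl
    map_r := fun _ _ => rfl
    bij_r := by
      obtain ⟨E, hE, hE'⟩ := IsLocalUnitsExtension.exists_localUnits (R := R)
      refine lid_bijective (A := R) hE (M := S) (fun a => AddMonoidHom.mul (a : S))
        (fun x => ?_) _ (fun _ _ => rfl)
      obtain ⟨_, ⟨e, -, rfl⟩, h, -⟩ := hE'.exists_unit x x
      exact ⟨e, h⟩
    bij_l := by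
      obtain ⟨E, hE, hE'⟩ := IsLocalUnitsExtension.exists_localUnits (R := R)
      refine rid_bijective (A := R) hE (M := S) (fun a => AddMonoidHom.mul.flip (a : S))
        (fun x => ?_) _ (fun _ _ => rfl)
      obtain ⟨_, ⟨e, -, rfl⟩, -, h, -⟩ := hE'.exists_unit x x
      exact ⟨e, h⟩ }

/-- The product of two morphisms of `M(S/R)`. -/
def tensorMap {f f' g g' : MObj R} (u : f ⟶ f') (v : g ⟶ g') : tensorProd f g ⟶ tensorProd f' g' where
  α := UBimod.tensorMap u.α v.α
  β := UBimod.tensorMap u.β v.β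
  comm := UBimod.tens_ext
    ((UBimod.Hom.toAddHom (UBimod.tensorMap u.β v.β)).comp (chi f g))
    ((chi f' g').comp (UBimod.Hom.toAddHom (UBimod.tensorMap u.α v.α)))
    (fun p q => congrArg₂ (fun x y => Tens.mk f'.X.r g'.X.l x y) (u.comm p) (v.comm q))

/-- The monoidal structure of `M(S/R)`, componentwise given by those of the categories of unital
`R`-bimodules and unital `S`-bimodules. -/
instance : MonoidalCategoryStruct (MObj R) where
  tensorObj := tensorProd
  tensorHom f g := tensorMap f g
  whiskerLeft P _ _ g := tensorMap (𝟙 P) g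
  whiskerRight f Q := tensorMap f (𝟙 Q)
  tensorUnit := unit R
  associator f g h := mkIso (UBimod.assoc f.P g.P h.P) (UBimod.assoc f.X g.X h.X) 
    (UBimod.tens_ext₃
      ((UBimod.Hom.toAddHom (UBimod.assoc f.X g.X h.X).hom).comp (chi (tensorProd f g) h))
      ((chi f (tensorProd g h)).comp (UBimod.Hom.toAddHom (UBimod.assoc f.P g.P h.P).hom))
      (fun _ _ _ => rfl))
  leftUnitor f :=
    have : HasLocalUnits S := IsLocalUnitsExtension.hasLocalUnits R
    mkIso (UBimod.lid f.P) (UBimod.lid f.X) 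
      (UBimod.tens_ext ((UBimod.Hom.toAddHom (UBimod.lid f.X).hom).comp (chi (unit R) f))
        (f.φ.comp (UBimod.Hom.toAddHom (UBimod.lid f.P).hom))
        (fun a p => (f.map_l a p).symm))
  rightUnitor f :=
    have : HasLocalUnits S := IsLocalUnitsExtension.hasLocalUnits R
    mkIso (UBimod.rid f.P) (UBimod.rid f.X) 
      (UBimod.tens_ext ((UBimod.Hom.toAddHom (UBimod.rid f.X).hom).comp (chi f (unit R)))
        (f.φ.comp (UBimod.Hom.toAddHom (UBimod.rid f.P).hom))
        (fun p a => (f.map_r a p).symm))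

instance : MonoidalCategory (MObj R) :=
  have : HasLocalUnits S := IsLocalUnitsExtension.hasLocalUnits R
  MonoidalCategory.ofTensorHom
    (id_tensorHom_id := fun f g =>
      hom_ext (id_tensorHom_id f.P g.P) (id_tensorHom_id f.X g.X))
    (id_tensorHom := fun _ _ _ _ => rfl)
    (tensorHom_id := fun _ _ => rfl)
    (tensorHom_comp_tensorHom := fun f₁ f₂ g₁ g₂ =>
      hom_ext (tensorHom_comp_tensorHom f₁.α f₂.α g₁.α g₂.α)
        (tensorHom_comp_tensorHom f₁.β f₂.β g₁.β g₂.β))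
    (associator_naturality := fun f₁ f₂ f₃ =>
      hom_ext (associator_naturality f₁.α f₂.α f₃.α) (associator_naturality f₁.β f₂.β f₃.β))
    (leftUnitor_naturality := fun f =>
      hom_ext (leftUnitor_naturality f.α) (leftUnitor_naturality f.β))
    (rightUnitor_naturality := fun f =>
      hom_ext (rightUnitor_naturality f.α) (rightUnitor_naturality f.β))
    (pentagon := fun f g h k =>
      hom_ext (pentagon f.P g.P h.P k.P) (pentagon f.X g.X h.X k.X))
    (triangle := fun f g => hom_ext (triangle f.P g.P) (triangle f.X g.X))

end MObj

variable [IsLocalUnitsExtension R]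

/-- The monoid `S(S/R)` of isomorphism classes of objects of `M(S/R)`, with multiplication and
unit induced by the monoidal structure (the `Monoid` instance is Mathlib's instance on the
skeleton of a monoidal category). -/
abbrev ScrS : Type (u + 1) := Skeleton (MObj R)

/-- The submonoid `P(S/R)` of `S(S/R)`: the classes of the objects `φ : P → X` with
`[P] ∈ Pic(R)` and `[X] ∈ Pic(S)`. -/
def ScrP : Submonoid (ScrS R) :=
  have : HasLocalUnits S := IsLocalUnitsExtension.hasLocalUnits R
  { carrier := {c | ∃ f : MObj R, c = toSkeleton f ∧
      toSkeleton f.P ∈ Pic R ∧ toSkeleton f.X ∈ Pic S}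
    one_mem' := ⟨MObj.unit R, rfl, (mem_Pic_iff _).2 isUnit_one, (mem_Pic_iff _).2 isUnit_one⟩
    mul_mem' := by
      rintro _ _ ⟨f, rfl, h1, h2⟩ ⟨g, rfl, h3, h4⟩
      rw [mem_Pic_iff] at h1 h2 h3 h4
      refine ⟨f ⊗ g, (Skeleton.toSkeleton_tensorObj f g).symm, ?_, ?_⟩
      · rw [mem_Pic_iff]
        exact (Skeleton.toSkeleton_tensorObj f.P g.P) ▸ h1.mul h3
      · rw [mem_Pic_iff]
        exact (Skeleton.toSkeleton_tensorObj f.X g.X) ▸ h2.mul h4 }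

end Extension

end UnitalBimodules

end

/-!
An invertible class in `S(S/R)` has invertible components, since an isomorphism in `M(S/R)` is a
pair of isomorphisms of bimodules. The content is the converse: if `P` and `X` are invertible, then
the object `φ : P → X` has an inverse `ψ : Q → Y`.

Let `Q` and `Y` be inverses of `P` and `X`. The isomorphisms `P ⊗_R Q ≅ R` and `Q ⊗_R P ≅ R` can be
corrected so that they form a strict Morita context (`MoritaContext.nonempty`), and likewise for `X`
and `Y`. Write `μ : P × Q → R`, `ν : Q × P → R` and `μ : X × Y → S`, `ν : Y × X → S` for the
pairings. For `q ∈ Q`, the map `ν(q, -) : P → R` extends to a right `S`-linear map on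
`X ≅ P ⊗_R S`, and this extension is the pairing with a unique element `ψ(q) ∈ Y`. So there is a map
`ψ` with `ν(ψ(q), φ(p)) = ν(q, p)` (`exists_dual`), and uniqueness makes it `R`-bilinear. The
associativity laws and the faithfulness of `X` then give the other adjunction formula
`μ(φ(p), ψ(q)) = μ(p, q)` (`pairing_phi_dual`). These two formulas say that the pairings are
isomorphisms from `φ ⊗ ψ` and `ψ ⊗ φ` to the unit object.

It remains to see that `ψ` is an object of `M(S/R)`. The associativity laws give
`ν(q, p) · y = ψ(q) · μ(φ(p), y)` in `Y` and `ν(q, p) · t = q ⊗ μ(φ(p), F(t))` in `Q ⊗_R S`, where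
`F : Q ⊗_R S → Y` is the map `q ⊗ s ↦ ψ(q) · s`. As the elements `ν(q, p)` span `R`, which contains
local units for `Y` and for `Q ⊗_R S`, the first identity shows that `F` is surjective and the second
that it is injective (`phiR_dual_bijective`); the map `S ⊗_R Q → Y` is treated in the same way
(`phiL_dual_bijective`).
-/

namespace UnitalBimodules

universe u

/-! ### Pairings of bimodules and Morita contexts -/

namespace UBimod

variable {A : Type u} [NonUnitalRing A] [HasLocalUnits A] {P Q : UBimod A}

/-- The balanced `A`-bilinear pairing `P × Q → A` given by a bimodule map `P ⊗_A Q → A`. -/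
def pairing (j : tensorProd P Q ⟶ unit A) (p : P) (q : Q) : A := j.toAddHom (tmul p q)

section pairing

variable (j : tensorProd P Q ⟶ unit A)

theorem pairing_add_left (p p' : P) (q : Q) :
    pairing j (p + p') q = pairing j p q + pairing j p' q :=
  (congrArg (fun z : Q →+ tensorProd P Q => j.toAddHom (z q))
    ((Tens.mk P.r Q.l).map_add p p')).trans (j.toAddHom.map_add (tmul p q) (tmul p' q))

theorem pairing_add_right (p : P) (q q' : Q) :
    pairing j p (q + q') = pairing j p q + pairing j p q' :=
  (congrArg j.toAddHom ((Tens.mk P.r Q.l p).map_add q q')).trans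
    (j.toAddHom.map_add (tmul p q) (tmul p q'))

theorem pairing_l (a : A) (p : P) (q : Q) : pairing j (P.l a p) q = a * pairing j p q :=
  j.map_l a (tmul p q)

theorem pairing_r (a : A) (p : P) (q : Q) : pairing j p (Q.r a q) = pairing j p q * a :=
  j.map_r a (tmul p q)

theorem pairing_balanced (a : A) (p : P) (q : Q) :
    pairing j (P.r a p) q = pairing j p (Q.l a q) :=
  congrArg j.toAddHom (Tens.balanced (ρ := P.r) (σ := Q.l) a p q)

/-- If `P ⊗_A Q → A` is an isomorphism, every element of `A` is a sum of values of the pairing. -/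
theorem pairing_induction (j : tensorProd P Q ≅ unit A) {C : A → Prop}
    (mem : ∀ p q, C (pairing j.hom p q)) (add : ∀ a b, C a → C b → C (a + b)) (a : A) : C a := by
  have h : j.hom.toAddHom (j.inv.toAddHom a) = a :=
    DFunLike.congr_fun (congrArg Hom.toAddHom j.inv_hom_id) a
  rw [← h]
  exact Tens.induction (ρ := P.r) (σ := Q.l) (p := fun t => C (j.hom.toAddHom t)) _ mem
    (fun s t hs ht => (j.hom.toAddHom.map_add s t).symm ▸ add _ _ hs ht)

end pairing

variable (P Q) in
/-- A strict Morita context on a pair of mutually inverse bimodules: isomorphisms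
`μ : P ⊗_A Q ≅ A` and `ν : Q ⊗_A P ≅ A` that satisfy the two associativity laws
`μ(p, q) · p' = p · ν(q, p')` and `ν(q, p) · q' = q · μ(p, q')`. -/
structure MoritaContext where
  μ : tensorProd P Q ≅ unit A
  ν : tensorProd Q P ≅ unit A
  assoc_left : ∀ p q p', P.l (pairing μ.hom p q) p' = P.r (pairing ν.hom q p') p
  assoc_right : ∀ q p q', Q.l (pairing ν.hom q p) q' = Q.r (pairing μ.hom p q') q

/-- For mutually inverse bimodules `P` and `Q`, the pairing `P × Q → A` has no right kernel; no
compatibility between the two isomorphisms is needed. -/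
theorem eq_of_pairing_eq (j : tensorProd P Q ≅ unit A) (i : tensorProd Q P ≅ unit A) {y y' : Q}
    (h : ∀ p, pairing j.hom p y = pairing j.hom p y') : y = y' := by
  have hj : ∀ t, j.inv.toAddHom (j.hom.toAddHom t) = t :=
    DFunLike.congr_fun (congrArg Hom.toAddHom j.hom_inv_id)
  have ht : ∀ p, tmul p y = tmul p y' := fun p => by
    rw [← hj (tmul p y), ← hj (tmul p y')]
    exact congrArg _ (h p)
  -- `Q ⊗ (P ⊗ Q) ≅ (Q ⊗ P) ⊗ Q ≅ A ⊗ Q ≅ Q` sends `q ⊗ (p ⊗ z)` to `i(q, p) · z`, which therefore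
  -- depends on `q` and `p ⊗ z` only.
  let i' : Q ⊗ P ≅ 𝟙_ (UBimod A) := i
  let F : Q ⊗ (P ⊗ Q) ⟶ Q := (α_ Q P Q).inv ≫ i'.hom ▷ Q ≫ (λ_ Q).hom
  have hF : ∀ q p z, F.toAddHom (tmul q (tmul p z)) = Q.l (pairing i.hom q p) z := fun q p z =>
    congrArg (Hom.toAddHom (i'.hom ▷ Q ≫ (λ_ Q).hom)) (DFunLike.congr_fun
      (congrArg Hom.toAddHom (α_ Q P Q).hom_inv_id) (tmul (tmul q p) z))
  have hl : ∀ a : A, Q.l a y = Q.l a y' := pairing_induction i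
    (fun q p => by rw [← hF, ht, hF])
    (fun a b ha hb => by rw [map_add, AddMonoidHom.add_apply, AddMonoidHom.add_apply, ha, hb])
  obtain ⟨E, hE⟩ := HasLocalUnits.exists_localUnits (A := A)
  obtain ⟨e, -, he⟩ := exists_unit_left hE Q.l Q.l_mul Q.l_unital (y - y')
  rw [← sub_eq_zero, ← he, map_sub, hl, sub_self]

/-- Any pair of isomorphisms `P ⊗_A Q ≅ A` and `Q ⊗_A P ≅ A` can be made associative: the defect
of the first associativity law is an automorphism `θ` of `P`, by which the second isomorphism is
corrected, and the second law then follows. -/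
theorem MoritaContext.nonempty (j : tensorProd P Q ≅ unit A) (i : tensorProd Q P ≅ unit A) :
    Nonempty (MoritaContext P Q) := by
  let j' : P ⊗ Q ≅ 𝟙_ (UBimod A) := j
  let i' : Q ⊗ P ≅ 𝟙_ (UBimod A) := i
  let θ : P ≅ P := (ρ_ P).symm ≪≫ whiskerLeftIso P i'.symm ≪≫ (α_ P Q P).symm ≪≫
    whiskerRightIso j' P ≪≫ λ_ P
  have hθ : (α_ P Q P).hom ≫ P ◁ i'.hom ≫ (ρ_ P).hom ≫ θ.hom = j'.hom ▷ P ≫ (λ_ P).hom := by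
    simp [θ]
  have hθ' : ∀ p q p', θ.hom.toAddHom (P.r (pairing i.hom q p') p) = P.l (pairing j.hom p q) p' :=
    fun p q p' => DFunLike.congr_fun (congrArg Hom.toAddHom hθ) (tmul (tmul p q) p')
  let ν : tensorProd Q P ≅ unit A := whiskerLeftIso Q θ ≪≫ i'
  have hν : ∀ q p, pairing ν.hom q p = pairing i.hom q (θ.hom.toAddHom p) := fun _ _ => rfl
  have hinj : Function.Injective θ.hom.toAddHom := fun x y h => by
    have hx : ∀ x, θ.inv.toAddHom (θ.hom.toAddHom x) = x :=
      DFunLike.congr_fun (congrArg Hom.toAddHom θ.hom_inv_id)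
    rw [← hx x, h, hx]
  have h1 : ∀ p q p', P.l (pairing j.hom p q) p' = P.r (pairing ν.hom q p') p := fun p q p' =>
    hinj (by rw [θ.hom.map_l, hν, hθ'])
  -- For the second law, pair both sides with `p'` and use the first law.
  refine ⟨⟨j, ν, h1, fun q p q' => eq_of_pairing_eq j i fun p' => ?_⟩⟩
  rw [← pairing_balanced, ← h1, pairing_l, pairing_r]

theorem exists_moritaContext (h : toSkeleton P ∈ Pic A) :
    ∃ Q : UBimod A, Nonempty (MoritaContext P Q) := by
  obtain ⟨P', Q, hP, ⟨i⟩, ⟨j⟩⟩ := h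
  obtain ⟨k⟩ : Nonempty (P ≅ P') := Quotient.exact hP
  exact ⟨Q, MoritaContext.nonempty (whiskerRightIso (C := UBimod A) k Q ≪≫ j)
    (whiskerLeftIso (C := UBimod A) Q k ≪≫ i)⟩

/-- The pairing `Q × P → A` of a Morita context has no left kernel. -/
theorem MoritaContext.eq_of_pairing_eq_left (m : MoritaContext P Q) {y y' : Q}
    (h : ∀ p, pairing m.ν.hom y p = pairing m.ν.hom y' p) : y = y' := by
  have hr : ∀ a : A, Q.r a y = Q.r a y' := pairing_induction m.μ
    (fun p q => by rw [← m.assoc_right, h, m.assoc_right])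
    (fun a b ha hb => by rw [map_add, AddMonoidHom.add_apply, AddMonoidHom.add_apply, ha, hb])
  obtain ⟨e, he⟩ := Q.exists_r (y - y')
  rw [← sub_eq_zero, ← he, map_sub, hr, sub_self]

/-- An invertible bimodule is faithful as a left module. -/
theorem MoritaContext.eq_of_l_eq (m : MoritaContext P Q) {a b : A}
    (h : ∀ p, P.l a p = P.l b p) : a = b := by
  have hr : ∀ c : A, a * c = b * c := pairing_induction m.μ
    (fun p q => by rw [← pairing_l, h, pairing_l])
    (fun c d hc hd => by rw [mul_add, mul_add, hc, hd])
  obtain ⟨E, hE⟩ := HasLocalUnits.exists_localUnits (A := A)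
  obtain ⟨e, -, -, ha, -, hb⟩ := hE.exists_unit a b
  rw [← ha, hr, hb]

end UBimod

/-! ### Local units on tensor products -/

section TensorAction

variable {A : Type u} [NonUnitalRing A] {E : Set A} {J : Type*} {M N : Type u}
  [AddCommGroup M] [AddCommGroup N]

/-- If `M` is a unital left module, so is `M ⊗ N`: its left action `L` through `M` is additive in the
scalar, and every tensor is fixed by some scalar. -/
theorem exists_tens_left_action (hE : IsSetOfLocalUnits E) (l : A →+ M →+ M)
    (l_mul : ∀ a b x, l (a * b) x = l a (l b x)) (hu : ∀ x, ∃ e, l e x = x)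
    (ρ : J → M →+ M) (σ : J → N →+ N) (hl : ∀ a j x, l a (ρ j x) = ρ j (l a x)) :
    ∃ L : A →+ Tens ρ σ →+ Tens ρ σ,
      (∀ a m n, L a (Tens.mk ρ σ m n) = Tens.mk ρ σ (l a m) n) ∧ ∀ t, ∃ e, L e t = t := by
  let L : A →+ Tens ρ σ →+ Tens ρ σ := AddMonoidHom.mk' (Tens.actL l ρ σ hl) fun a b =>
    Tens.hom_ext fun m n => (congrArg (fun z => Tens.mk ρ σ (z m) n) (l.map_add a b)).trans
      (((Tens.mk ρ σ).flip n).map_add (l a m) (l b m))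
  refine ⟨L, fun _ _ _ => rfl, fun t => ?_⟩
  obtain ⟨e, -, he⟩ := exists_unit_left hE L
    (fun a b => Tens.ext_apply (L (a * b)) ((L a).comp (L b))
      (fun m n => congrArg (fun z => Tens.mk ρ σ z n) (l_mul a b m)))
    (eq_top_iff.2 fun t _ => Tens.induction t (fun m n => by
      obtain ⟨e, he⟩ := hu m
      exact AddSubgroup.subset_closure
        ⟨e, Tens.mk ρ σ m n, congrArg (fun z => Tens.mk ρ σ z n) he.symm⟩)
      (fun _ _ => add_mem)) t
  exact ⟨e, he⟩

/-- If `N` is a unital right module, so is `M ⊗ N`: its right action `L` through `N` is additive in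
the scalar, and every tensor is fixed by some scalar. -/
theorem exists_tens_right_action (hE : IsSetOfLocalUnits E) (r : A →+ N →+ N)
    (r_mul : ∀ a b x, r (a * b) x = r b (r a x)) (hu : ∀ x, ∃ e, r e x = x)
    (ρ : J → M →+ M) (σ : J → N →+ N) (hr : ∀ j a x, σ j (r a x) = r a (σ j x)) :
    ∃ L : A →+ Tens ρ σ →+ Tens ρ σ,
      (∀ a m n, L a (Tens.mk ρ σ m n) = Tens.mk ρ σ m (r a n)) ∧ ∀ t, ∃ e, L e t = t := by
  let L : A →+ Tens ρ σ →+ Tens ρ σ := AddMonoidHom.mk' (Tens.actR ρ σ r hr) fun a b =>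
    Tens.hom_ext fun m n => (congrArg (fun z => Tens.mk ρ σ m (z n)) (r.map_add a b)).trans
      ((Tens.mk ρ σ m).map_add (r a n) (r b n))
  refine ⟨L, fun _ _ _ => rfl, fun t => ?_⟩
  obtain ⟨e, -, he⟩ := exists_unit_right hE L
    (fun a b => Tens.ext_apply (L (a * b)) ((L b).comp (L a))
      (fun m n => congrArg (fun z => Tens.mk ρ σ m z) (r_mul a b n)))
    (eq_top_iff.2 fun t _ => Tens.induction t (fun m n => by
      obtain ⟨e, he⟩ := hu n
      exact AddSubgroup.subset_closure
        ⟨e, Tens.mk ρ σ m n, congrArg (fun z => Tens.mk ρ σ m z) he.symm⟩)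
      (fun _ _ => add_mem)) t
  exact ⟨e, he⟩

end TensorAction

/-! ### The inverse of an object of the monoidal category -/

namespace MObj

open UBimod

variable {S : Type u} [NonUnitalRing S] {R : NonUnitalSubring S}

/-- `X` is additively spanned by the elements `φ(p) · s`. -/
theorem phi_induction (f : MObj R) {C : f.X → Prop} (mem : ∀ p s, C (f.X.r s (f.φ p)))
    (add : ∀ x y, C x → C y → C (x + y)) (x : f.X) : C x := by
  obtain ⟨t, rfl⟩ := f.bij_r.2 x
  exact Tens.induction t mem fun s t hs ht => (map_add (phiR f.φ f.map_r) s t).symm ▸ add _ _ hs ht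

section dual

variable [HasLocalUnits S] {f : MObj R} {Y : UBimod S} (n : MoritaContext f.X Y)

/-- An element of `Y` is determined by its pairings with the image of `P`. -/
theorem eq_of_pairing_phi_eq {y y' : Y}
    (h : ∀ p, pairing n.ν.hom y (f.φ p) = pairing n.ν.hom y' (f.φ p)) : y = y' :=
  n.eq_of_pairing_eq_left <| phi_induction f
    (fun p s => by rw [pairing_r, h, pairing_r])
    (fun x x' hx hx' => by rw [pairing_add_right, hx, hx', pairing_add_right])

/-- Every right `S`-linear map `b : X → S`, precomposed with the left action of an element of `S`,
is the pairing with an element of `Y`. -/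
theorem exists_represents (b : f.X →+ S) (hb : ∀ s x, b (f.X.r s x) = b x * s) (a : S) :
    ∃ y : Y, ∀ x, pairing n.ν.hom y x = b (f.X.l a x) := by
  -- For `a = μ(x₀, y₀)` take `y = b(x₀) · y₀`: then `ν(y, x) = b(x₀ · ν(y₀, x)) = b(μ(x₀, y₀) · x)`.
  refine pairing_induction (C := fun a => ∃ y : Y, ∀ x, pairing n.ν.hom y x = b (f.X.l a x)) n.μ
    (fun x₀ y₀ => ⟨Y.l (b x₀) y₀, fun x => ?_⟩) ?_ a
  · rw [pairing_l, ← hb, n.assoc_left]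
  · rintro c d ⟨y, hy⟩ ⟨z, hz⟩
    exact ⟨y + z, fun x => by
      rw [pairing_add_left, hy, hz, map_add, AddMonoidHom.add_apply, map_add]⟩

end dual

variable [IsLocalUnitsExtension R]

/-- A right `R`-linear map `P → R` extends to a right `S`-linear map `X → S`, because
`X ≅ P ⊗_R S`. -/
theorem exists_extension (f : MObj R) (g : f.P →+ R)
    (hg : ∀ (a : R) p, g (f.P.r a p) = g p * a) :
    ∃ b : f.X →+ S, (∀ p, b (f.φ p) = g p) ∧ ∀ s x, b (f.X.r s x) = b x * s := by
  let e := AddEquiv.ofBijective (phiR f.φ f.map_r) f.bij_r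
  let b' : Tens f.P.r (fun a : R => AddMonoidHom.mul (a : S)) →+ S :=
    Tens.lift (AddMonoidHom.mul.comp ((R.subtype : R →+ S).comp g)) (fun a p s => by
      simp [hg, mul_assoc])
  let b : f.X →+ S := b'.comp e.symm.toAddMonoidHom
  have hb : ∀ p s, b (f.X.r s (f.φ p)) = g p * s := fun p s =>
    congrArg b' (e.symm_apply_apply (Tens.mk _ _ p s))
  refine ⟨b, fun p => ?_, fun s => phi_induction f (fun p t => ?_) (fun x y hx hy => ?_)⟩
  · obtain ⟨a, ha⟩ := f.P.exists_r p
    rw [← ha, f.map_r, hb, hg]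
    rfl
  · rw [← f.X.r_mul, hb, hb, mul_assoc]
  · rw [map_add, map_add, map_add, hx, hy, add_mul]

section dual

variable [HasLocalUnits S] {f : MObj R} {Q : UBimod R} {Y : UBimod S}
  (m : MoritaContext f.P Q) (n : MoritaContext f.X Y)

/-- The value `y = ψ(q)` of the adjoint map at a single element `q`. -/
theorem exists_dual_apply (q : Q) :
    ∃ y : Y, ∀ p, pairing n.ν.hom y (f.φ p) = (pairing m.ν.hom q p : R) := by
  obtain ⟨b, hb, hb'⟩ := exists_extension f
    (AddMonoidHom.mk' (fun p => (pairing m.ν.hom q p : R)) (pairing_add_right m.ν.hom q))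
    (fun a p => pairing_r m.ν.hom a q p)
  -- As `q · e = q`, precomposing with the action of `e ∈ R` does not change `b` on `φ(P)`.
  obtain ⟨e, he⟩ := Q.exists_r q
  obtain ⟨y, hy⟩ := exists_represents n b hb' e
  refine ⟨y, fun p => ?_⟩
  rw [hy, ← f.map_l, hb, AddMonoidHom.mk'_apply, ← pairing_balanced, he]

/-- There is an `R`-bilinear map `ψ : Q → Y` that is adjoint to `φ : P → X` for the pairings
`Q × P → R` and `Y × X → S`. It is the underlying map of the inverse of `φ` in `M(S/R)`. -/
theorem exists_dual : ∃ ψ : Q →+ Y,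
    (∀ q p, pairing n.ν.hom (ψ q) (f.φ p) = (pairing m.ν.hom q p : R)) ∧
    (∀ (a : R) q, ψ (Q.l a q) = Y.l (a : S) (ψ q)) ∧
    (∀ (a : R) q, ψ (Q.r a q) = Y.r (a : S) (ψ q)) := by
  choose ψ hψ using exists_dual_apply m n
  refine ⟨AddMonoidHom.mk' ψ fun q q' => ?_, hψ, fun a q => ?_, fun a q => ?_⟩
  · refine eq_of_pairing_phi_eq n fun p => ?_
    rw [hψ, pairing_add_left, pairing_add_left, hψ, hψ]
    rfl
  · refine eq_of_pairing_phi_eq n fun p => ?_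
    simp only [AddMonoidHom.mk'_apply]
    rw [hψ, pairing_l, pairing_l, hψ]
    rfl
  · refine eq_of_pairing_phi_eq n fun p => ?_
    simp only [AddMonoidHom.mk'_apply]
    rw [hψ, pairing_balanced, pairing_balanced, ← f.map_l, hψ]

variable {m n}

/-- A map adjoint to `φ` on one side is adjoint to it on the other side as well. -/
theorem pairing_phi_dual {ψ : Q →+ Y}
    (hψ : ∀ q p, pairing n.ν.hom (ψ q) (f.φ p) = (pairing m.ν.hom q p : R)) (p : f.P) (q : Q) :
    pairing n.μ.hom (f.φ p) (ψ q) = (pairing m.μ.hom p q : R) := by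
  -- Both sides act in the same way on the generators `φ(p') · s` of the faithful module `X`.
  refine n.eq_of_l_eq <| phi_induction f (fun p' s => ?_) (fun x y hx hy => ?_)
  · rw [n.assoc_left, pairing_r, f.X.r_mul, hψ, ← f.map_r, ← m.assoc_left, f.map_l, f.X.lr]
  · rw [map_add, map_add, hx, hy]

/-- If `ψ : Q → Y` is adjoint to `φ`, then `Q ⊗_R S → Y`, `q ⊗ s ↦ ψ(q) · s`, is bijective. -/
theorem phiR_dual_bijective {ψ : Q →+ Y}
    (hψ : ∀ q p, pairing n.ν.hom (ψ q) (f.φ p) = (pairing m.ν.hom q p : R))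
    (map_r : ∀ (a : R) q, ψ (Q.r a q) = Y.r (a : S) (ψ q)) :
    Function.Bijective (phiR ψ map_r) := by
  obtain ⟨E, hE, hE'⟩ := IsLocalUnitsExtension.exists_localUnits (R := R)
  refine ⟨(injective_iff_map_eq_zero _).2 fun t ht => ?_, fun y => ?_⟩
  · obtain ⟨L, hL, hu⟩ := exists_tens_left_action hE Q.l Q.l_mul Q.exists_l Q.r
      (fun a : R => AddMonoidHom.mul (a : S)) Q.lr
    -- The action of `ν(q, p)` on `Q ⊗_R S` factors through the map to `Y`.
    have key : ∀ q p t, L (pairing m.ν.hom q p) t =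
        Tens.mk _ _ q (pairing n.μ.hom (f.φ p) (phiR ψ map_r t)) := fun q p t => by
      refine Tens.induction t (fun q' s => ?_) (fun x y hx hy => ?_)
      · have h : phiR ψ map_r (Tens.mk _ _ q' s) = Y.r s (ψ q') := rfl
        rw [hL, m.assoc_right, Tens.balanced, h, pairing_r, pairing_phi_dual hψ]
        rfl
      · rw [map_add, hx, hy, map_add, pairing_add_right, map_add]
    have hzero : ∀ a, L a t = 0 := pairing_induction m.ν
      (fun q p => by rw [key, ht, ← map_zero (phiR ψ map_r), ← key, map_zero])
      (fun a b ha hb => by rw [map_add, AddMonoidHom.add_apply, ha, hb, add_zero])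
    obtain ⟨e, he⟩ := hu t
    rw [← he, hzero]
  · -- `ν(q, p) · y = ψ(q) · μ(φ(p), y)` lies in the image.
    have key : ∀ a : R, ∃ t, phiR ψ map_r t = Y.l (a : S) y := pairing_induction m.ν
      (fun q p => ⟨Tens.mk _ _ q (pairing n.μ.hom (f.φ p) y), by
        rw [← hψ, n.assoc_right]
        rfl⟩)
      (by
        rintro a b ⟨s, hs⟩ ⟨t, ht⟩
        exact ⟨s + t, by
          rw [map_add, hs, ht, R.coe_add, map_add, AddMonoidHom.add_apply]⟩)
    obtain ⟨_, ⟨e, -, rfl⟩, he⟩ := exists_unit_left hE' Y.l Y.l_mul Y.l_unital y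
    rw [← he]
    exact key e

/-- If `ψ : Q → Y` is adjoint to `φ`, then `S ⊗_R Q → Y`, `s ⊗ q ↦ s · ψ(q)`, is bijective. -/
theorem phiL_dual_bijective {ψ : Q →+ Y}
    (hψ : ∀ q p, pairing n.ν.hom (ψ q) (f.φ p) = (pairing m.ν.hom q p : R))
    (map_l : ∀ (a : R) q, ψ (Q.l a q) = Y.l (a : S) (ψ q)) :
    Function.Bijective (phiL ψ map_l) := by
  obtain ⟨E, hE, hE'⟩ := IsLocalUnitsExtension.exists_localUnits (R := R)
  refine ⟨(injective_iff_map_eq_zero _).2 fun t ht => ?_, fun y => ?_⟩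
  · obtain ⟨L, hL, hu⟩ := exists_tens_right_action hE Q.r Q.r_mul Q.exists_r
      (fun a : R => AddMonoidHom.mul.flip (a : S)) Q.l Q.lr
    -- The action of `μ(p, q)` on `S ⊗_R Q` factors through the map to `Y`.
    have key : ∀ p q t, L (pairing m.μ.hom p q) t =
        Tens.mk _ _ (pairing n.ν.hom (phiL ψ map_l t) (f.φ p)) q := fun p q t => by
      refine Tens.induction t (fun s q' => ?_) (fun x y hx hy => ?_)
      · have h : phiL ψ map_l (Tens.mk _ _ s q') = Y.l s (ψ q') := rfl
        rw [hL, ← m.assoc_right, ← Tens.balanced, h, pairing_l, hψ]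
        rfl
      · rw [map_add, hx, hy, map_add, pairing_add_left, map_add, AddMonoidHom.add_apply]
    have hzero : ∀ a, L a t = 0 := pairing_induction m.μ
      (fun p q => by rw [key, ht, ← map_zero (phiL ψ map_l), ← key, map_zero])
      (fun a b ha hb => by rw [map_add, AddMonoidHom.add_apply, ha, hb, add_zero])
    obtain ⟨e, he⟩ := hu t
    rw [← he, hzero]
  · -- `y · μ(p, q) = ν(y, φ(p)) · ψ(q)` lies in the image.
    have key : ∀ a : R, ∃ t, phiL ψ map_l t = Y.r (a : S) y := pairing_induction m.μ
      (fun p q => ⟨Tens.mk _ _ (pairing n.ν.hom y (f.φ p)) q, by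
        rw [← pairing_phi_dual hψ, ← n.assoc_right]
        rfl⟩)
      (by
        rintro a b ⟨s, hs⟩ ⟨t, ht⟩
        exact ⟨s + t, by
          rw [map_add, hs, ht, R.coe_add, map_add, AddMonoidHom.add_apply]⟩)
    obtain ⟨_, ⟨e, -, rfl⟩, he⟩ := exists_unit_right hE' Y.r Y.r_mul Y.r_unital y
    rw [← he]
    exact key e

/-- The class of `φ : P → X` is invertible as soon as `P` and `X` are. -/
theorem isUnit_toSkeleton (m : MoritaContext f.P Q) (n : MoritaContext f.X Y) :
    IsUnit (toSkeleton f) := by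
  obtain ⟨ψ, hψ, map_l, map_r⟩ := exists_dual m n
  let g : MObj R :=
    { P := Q
      X := Y
      φ := ψ
      map_l := map_l
      map_r := map_r
      bij_r := phiR_dual_bijective hψ map_r
      bij_l := phiL_dual_bijective hψ map_l }
  let i : tensorProd f g ≅ unit R := mkIso m.μ n.μ
    (tens_ext (n.μ.hom.toAddHom.comp (chi f g)) ((unit R).φ.comp m.μ.hom.toAddHom)
      (pairing_phi_dual hψ))
  let j : tensorProd g f ≅ unit R := mkIso m.ν n.ν
    (tens_ext (n.ν.hom.toAddHom.comp (chi g f)) ((unit R).φ.comp m.ν.hom.toAddHom) hψ)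
  refine ⟨⟨toSkeleton f, toSkeleton g, ?_, ?_⟩, rfl⟩
  · rw [← Skeleton.toSkeleton_tensorObj, Skeleton.one_eq]
    exact Quotient.sound ⟨i⟩
  · rw [← Skeleton.toSkeleton_tensorObj, Skeleton.one_eq]
    exact Quotient.sound ⟨j⟩

end dual

/-! ### Components of isomorphisms, and the units -/

/-- The first component of an isomorphism of `M(S/R)`. -/
def isoP {f g : MObj R} (i : f ≅ g) : f.P ≅ g.P :=
  ⟨i.hom.α, i.inv.α, congrArg Hom.α i.hom_inv_id, congrArg Hom.α i.inv_hom_id⟩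

/-- The second component of an isomorphism of `M(S/R)`. -/
def isoX {f g : MObj R} (i : f ≅ g) : f.X ≅ g.X :=
  ⟨i.hom.β, i.inv.β, congrArg Hom.β i.hom_inv_id, congrArg Hom.β i.inv_hom_id⟩

end MObj

end UnitalBimodules

theorem mainTheorem3 {S : Type*} [NonUnitalRing S] (R : NonUnitalSubring S)
    [UnitalBimodules.IsLocalUnitsExtension R] :
    UnitalBimodules.ScrP R = IsUnit.submonoid (UnitalBimodules.ScrS R) := by
  have : UnitalBimodules.HasLocalUnits S := UnitalBimodules.IsLocalUnitsExtension.hasLocalUnits R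
  ext c
  constructor
  · rintro ⟨f, rfl, hP, hX⟩
    obtain ⟨Q, ⟨m⟩⟩ := UnitalBimodules.UBimod.exists_moritaContext hP
    obtain ⟨Y, ⟨n⟩⟩ := UnitalBimodules.UBimod.exists_moritaContext hX
    exact UnitalBimodules.MObj.isUnit_toSkeleton m n
  · rintro ⟨⟨x, y, hxy, hyx⟩, rfl⟩
    obtain ⟨f, rfl⟩ := Quotient.exists_rep x
    obtain ⟨g, rfl⟩ := Quotient.exists_rep y
    obtain ⟨i⟩ : Nonempty (UnitalBimodules.MObj.tensorProd f g ≅ UnitalBimodules.MObj.unit R) :=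
      Quotient.exact ((Skeleton.toSkeleton_tensorObj f g).trans hxy)
    obtain ⟨j⟩ : Nonempty (UnitalBimodules.MObj.tensorProd g f ≅ UnitalBimodules.MObj.unit R) :=
      Quotient.exact ((Skeleton.toSkeleton_tensorObj g f).trans hyx)
    exact ⟨f, rfl, ⟨f.P, g.P, rfl, ⟨UnitalBimodules.MObj.isoP j⟩, ⟨UnitalBimodules.MObj.isoP i⟩⟩,
      ⟨f.X, g.X, rfl, ⟨UnitalBimodules.MObj.isoX j⟩, ⟨UnitalBimodules.MObj.isoX i⟩⟩⟩
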